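/- Let $0\le\theta<\pi$, let $V,W\in C^\infty([0,1];\mathbb R)$ with $V(0)>0$, and let $\phi,\psi:[0,\infty)\to\mathbb R$ be smooth functions that are identically $1$ near $0$ and satisfy $\operatorname{supp}\phi\subset\operatorname{supp}\psi\subset[0,1)$ and $\operatorname{supp}\phi\cap\operatorname{supp}d\psi=\emptyset$. Put $\widetilde V_\psi:=\psi\,(V-V(0))$ and $W_\psi:=\psi W$ (both extended by $0$ to $[0,\infty)$), and assume that $\operatorname{supp}\psi$ is so small that $\|\widetilde V_\psi\|_\infty\le\frac12V(0)$. For real $\lambda,z$ let $\mu=\mu(\lambda,z):=\sqrt{\lambda^2V(0)+z^2}$ and $\lambda(V,W):=\lambda^2\widetilde V_\psi+W_\psi$. On $L^2(\mathbb R_+)$ let $K_\theta=K_\theta(\mu)$ and $K_{\mathbb R}=K_{\mathbb R}(\mu)$ be the integral operators with the kernels ($x,y>0$) $$K_\theta(x,y;\mu)=\frac1{2\mu}\Bigl[e^{-\mu|x-y|}+C(\mu,\theta)\,e^{-\mu(x+y)}\Bigr],\quad C(\mu,\theta)=\frac{\mu\sin\theta+\cos\theta}{\mu\sin\theta-\cos\theta},\qquad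 K_{\mathbb R}(x,y;\mu)=\frac1{2\mu}e^{-\mu|x-y|},$$ that is, the resolvent kernels of $-d^2/dx^2$ on the half-line with the boundary condition $\cos\theta\,f(0)+\sin\theta\,f'(0)=0$, and on the whole line (restricted to $\mathbb R_+\times\mathbb R_+$). For $N\in\mathbb N_0$ put $$R^{0N}_\partial(\lambda,z):=(-1)^N\,\psi\Bigl([K_\theta\,\lambda(V,W)]^NK_\theta-[K_{\mathbb R}\,\lambda(V,W)]^NK_{\mathbb R}\Bigr)\phi,$$ where functions act as multiplication operators. Derivatives with respect to $\lambda$ and $z$ are taken in the operator norm on $L^2(\mathbb R_+)$, and $\|\cdot\|_{\mathrm{tr}}$ is the trace norm. **Proposition.** Let $M\in\mathbb N$, $M\ge1$, and $\gamma,\nu\in\mathbb N_0$ be fixed. For all sufficiently large $\mu_0$ the following holds. 1. There are constants $C>0$ and $0<q<1$ such that for all $N\ge M$ and all real $(\lambda,z)$ with $\mu(\lambda,z)\ge\mu_0$ the family $R^{0N}_\partial$ is smooth at $(\lambda,z)$ and $$\bigl\|\partial_\lambda^\gamma\partial_z^\nu R^{0N}_\partial(\lambda,z)\bigr\|_{\mathrm{tr}}\le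 C\cdot N\cdot q^{N-M}\cdot\mu^{-M-\gamma-\nu-3/2}.$$ 2. Consequently, for all real $(\lambda,z)$ with $\mu(\lambda,z)\ge\mu_0$ the series $\sum_{j=M}^\infty R^{0j}_\partial(\lambda,z)$ converges in operator norm, its sum is smooth at $(\lambda,z)$, and, with a constant $C>0$ independent of $(\lambda,z)$, $$\Bigl\|\partial_\lambda^\gamma\partial_z^\nu\sum_{j=M}^\infty R^{0j}_\partial(\lambda,z)\Bigr\|_{\mathrm{tr}}\le C\,\mu^{-M-\gamma-\nu-3/2}.$$ -/

import Mathlib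

open MeasureTheory
open scoped ENNReal NNReal ContDiff

noncomputable section

/-! ### Operators on the half-line -/

/-- Lebesgue measure on the open half-line `(0, ∞)`. -/
abbrev halfLine : Measure ℝ := volume.restrict (Set.Ioi 0)

/-- The complex Hilbert space `L²(ℝ₊)`. -/
abbrev HalfL2 : Type := Lp ℂ 2 halfLine

/-- Schur's condition on an integral kernel on the half-line: the kernel is measurable and the
integrals of its modulus over either variable are bounded uniformly in the other variable. -/
structure IsSchurKernel (k : ℝ → ℝ → ℂ) : Prop where
  measurable : Measurable (Function.uncurry k)
  bound : ∃ C : ℝ≥0, (∀ᵐ x ∂halfLine, ∫⁻ y, ‖k x y‖ₑ ∂halfLine ≤ C) ∧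
    (∀ᵐ y ∂halfLine, ∫⁻ x, ‖k x y‖ₑ ∂halfLine ≤ C)

theorem schur_sq_le {k f : ℝ → ℝ≥0∞} (hk : Measurable k) (hf : AEMeasurable f halfLine) :
    (∫⁻ y, k y * f y ∂halfLine) ^ 2 ≤
      (∫⁻ y, k y ∂halfLine) * ∫⁻ y, k y * f y ^ 2 ∂halfLine := by
  have h := ENNReal.lintegral_mul_le_Lp_mul_Lq halfLine Real.HolderConjugate.two_two
    (f := fun y => k y ^ (1 / 2 : ℝ)) (g := fun y => k y ^ (1 / 2 : ℝ) * f y)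
    (hk.pow_const _).aemeasurable ((hk.pow_const _).aemeasurable.mul hf)
  have e1 : ∀ a : ℝ≥0∞, a ^ (1 / 2 : ℝ) * a ^ (1 / 2 : ℝ) = a := by
    intro a
    rw [← ENNReal.rpow_add_of_nonneg _ _ (by norm_num) (by norm_num)]
    norm_num
  have e2 : ∀ a : ℝ≥0∞, (a ^ (1 / 2 : ℝ)) ^ 2 = a := fun a => by rw [sq, e1]
  simp only [Pi.mul_apply, ENNReal.rpow_two, mul_pow, e2, ← mul_assoc, e1] at h
  refine (pow_le_pow_left' h 2).trans_eq ?_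
  rw [mul_pow, e2, e2]

theorem schur_lintegral_le {k : ℝ → ℝ → ℂ} (hk : Measurable (Function.uncurry k)) {C : ℝ≥0}
    (h1 : ∀ᵐ x ∂halfLine, ∫⁻ y, ‖k x y‖ₑ ∂halfLine ≤ C)
    (h2 : ∀ᵐ y ∂halfLine, ∫⁻ x, ‖k x y‖ₑ ∂halfLine ≤ C) (f : HalfL2) :
    ∫⁻ x, (∫⁻ y, ‖k x y‖ₑ * ‖f y‖ₑ ∂halfLine) ^ 2 ∂halfLine ≤
      (C : ℝ≥0∞) ^ 2 * ∫⁻ y, ‖f y‖ₑ ^ 2 ∂halfLine := by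
  have hf : Measurable (fun y => ‖f y‖ₑ) := (Lp.stronglyMeasurable f).measurable.enorm
  have hk' : Measurable (Function.uncurry fun x y => ‖k x y‖ₑ) := hk.enorm
  calc ∫⁻ x, (∫⁻ y, ‖k x y‖ₑ * ‖f y‖ₑ ∂halfLine) ^ 2 ∂halfLine
      ≤ ∫⁻ x, C * ∫⁻ y, ‖k x y‖ₑ * ‖f y‖ₑ ^ 2 ∂halfLine ∂halfLine := by
        refine lintegral_mono_ae ?_
        filter_upwards [h1] with x hx
        refine (schur_sq_le (hk'.of_uncurry_left (x := x)) hf.aemeasurable).trans ?_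
        gcongr
    _ = C * ∫⁻ x, ∫⁻ y, ‖k x y‖ₑ * ‖f y‖ₑ ^ 2 ∂halfLine ∂halfLine :=
        lintegral_const_mul' _ _ ENNReal.coe_ne_top
    _ = C * ∫⁻ y, ∫⁻ x, ‖k x y‖ₑ * ‖f y‖ₑ ^ 2 ∂halfLine ∂halfLine := by
        rw [lintegral_lintegral_swap]
        exact (hk'.mul ((hf.pow_const 2).comp measurable_snd)).aemeasurable
    _ = C * ∫⁻ y, (∫⁻ x, ‖k x y‖ₑ ∂halfLine) * ‖f y‖ₑ ^ 2 ∂halfLine := by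
        congr 1
        refine lintegral_congr fun y => ?_
        exact lintegral_mul_const _ (hk'.of_uncurry_right (y := y))
    _ ≤ C * ∫⁻ y, C * ‖f y‖ₑ ^ 2 ∂halfLine := by
        refine mul_le_mul_right (lintegral_mono_ae ?_) _
        filter_upwards [h2] with y hy
        exact mul_le_mul_left hy _
    _ = (C : ℝ≥0∞) ^ 2 * ∫⁻ y, ‖f y‖ₑ ^ 2 ∂halfLine := by
        rw [lintegral_const_mul' _ _ ENNReal.coe_ne_top, ← mul_assoc, sq]

theorem enorm_sq_halfL2 (g : ℝ → ℂ) :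
    eLpNorm g 2 halfLine = (∫⁻ x, ‖g x‖ₑ ^ 2 ∂halfLine) ^ (1 / 2 : ℝ) := by
  rw [eLpNorm_eq_lintegral_rpow_enorm_toReal (by norm_num) (by norm_num)]
  simp

theorem schur_integrable {k : ℝ → ℝ → ℂ} (hk : IsSchurKernel k) (f : HalfL2) :
    ∀ᵐ x ∂halfLine, Integrable (fun y => k x y * f y) halfLine := by
  obtain ⟨hm, C, h1, h2⟩ := hk
  have hf : Measurable f := (Lp.stronglyMeasurable f).measurable
  have hfin : ∫⁻ y, ‖f y‖ₑ ^ 2 ∂halfLine ≠ ⊤ := by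
    intro h
    have := (Lp.memLp f).2
    rw [enorm_sq_halfL2, h] at this
    simp at this
  have hle := schur_lintegral_le hm h1 h2 f
  have hm' : Measurable fun x => (∫⁻ y, ‖k x y‖ₑ * ‖f y‖ₑ ∂halfLine) ^ 2 := by
    have : Measurable (fun p : ℝ × ℝ => ‖k p.1 p.2‖ₑ * ‖f p.2‖ₑ) :=
      hm.enorm.mul (hf.comp measurable_snd).enorm
    exact (this.lintegral_prod_right' (ν := halfLine)).pow_const 2
  have := ae_lt_top hm' (ne_top_of_le_ne_top (ENNReal.mul_ne_top (by simp) hfin) hle)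
  filter_upwards [this] with x hx
  refine ⟨((hm.of_uncurry_left (x := x)).mul hf).aestronglyMeasurable, ?_⟩
  simp only [HasFiniteIntegral, enorm_mul]
  by_contra hcon
  rw [not_lt, top_le_iff] at hcon
  rw [hcon] at hx
  simp at hx

theorem schur_eLpNorm_le {k : ℝ → ℝ → ℂ} (hm : Measurable (Function.uncurry k)) {C : ℝ≥0}
    (h1 : ∀ᵐ x ∂halfLine, ∫⁻ y, ‖k x y‖ₑ ∂halfLine ≤ C)
    (h2 : ∀ᵐ y ∂halfLine, ∫⁻ x, ‖k x y‖ₑ ∂halfLine ≤ C) (f : HalfL2) :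
    eLpNorm (fun x => ∫ y, k x y * f y ∂halfLine) 2 halfLine ≤ C * eLpNorm f 2 halfLine := by
  rw [enorm_sq_halfL2, enorm_sq_halfL2]
  have e : ((C : ℝ≥0∞) ^ 2) ^ (1 / 2 : ℝ) = C := by
    rw [← ENNReal.rpow_two, ← ENNReal.rpow_mul]; norm_num
  calc (∫⁻ x, ‖∫ y, k x y * f y ∂halfLine‖ₑ ^ 2 ∂halfLine) ^ (1 / 2 : ℝ)
      ≤ ((C : ℝ≥0∞) ^ 2 * ∫⁻ y, ‖f y‖ₑ ^ 2 ∂halfLine) ^ (1 / 2 : ℝ) := by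
        gcongr
        refine le_trans (lintegral_mono fun x => ?_) (schur_lintegral_le hm h1 h2 f)
        gcongr
        refine (enorm_integral_le_lintegral_enorm _).trans_eq ?_
        simp only [enorm_mul]
    _ = _ := by rw [ENNReal.mul_rpow_of_nonneg _ _ (by norm_num), e]

theorem schur_memLp {k : ℝ → ℝ → ℂ} (hk : IsSchurKernel k) (f : HalfL2) :
    MemLp (fun x => ∫ y, k x y * f y ∂halfLine) 2 halfLine := by
  obtain ⟨hm, C, h1, h2⟩ := hk
  have hf : Measurable f := (Lp.stronglyMeasurable f).measurable
  refine ⟨?_, (schur_eLpNorm_le hm h1 h2 f).trans_lt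
    (ENNReal.mul_lt_top ENNReal.coe_lt_top (Lp.memLp f).2)⟩
  have : StronglyMeasurable (Function.uncurry fun x y => k x y * f y) :=
    (hm.mul (hf.comp measurable_snd)).stronglyMeasurable
  exact this.integral_prod_right.aestronglyMeasurable

/-- The bounded operator `(T f)(x) = ∫₀^∞ k(x, y) f(y) dy` on `L²(ℝ₊)` of a Schur kernel. -/
def schurOp (k : ℝ → ℝ → ℂ) (hk : IsSchurKernel k) : HalfL2 →L[ℂ] HalfL2 :=
  LinearMap.mkContinuousOfExistsBound
    { toFun := fun f => (schur_memLp hk f).toLp _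
      map_add' := fun f g => by
        rw [← MemLp.toLp_add]
        refine MemLp.toLp_congr _ _ ?_
        filter_upwards [schur_integrable hk f, schur_integrable hk g] with x hf hg
        rw [Pi.add_apply, ← integral_add hf hg]
        refine integral_congr_ae ?_
        filter_upwards [Lp.coeFn_add f g] with y hy
        rw [hy, Pi.add_apply, mul_add]
      map_smul' := fun c f => by
        rw [RingHom.id_apply, ← MemLp.toLp_const_smul]
        refine MemLp.toLp_congr _ _ (Filter.Eventually.of_forall fun x => ?_)
        rw [Pi.smul_apply, ← integral_smul]
        refine integral_congr_ae ?_
        filter_upwards [Lp.coeFn_smul c f] with y hy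
        rw [hy, Pi.smul_apply, smul_eq_mul, smul_eq_mul]
        ring }
    (by
      obtain ⟨hm, C, h1, h2⟩ := hk
      refine ⟨C, fun f => ?_⟩
      have h := schur_eLpNorm_le hm h1 h2 f
      simp only [LinearMap.coe_mk, AddHom.coe_mk, Lp.norm_toLp]
      rw [Lp.norm_def]
      have := ENNReal.toReal_mono
        (ENNReal.mul_ne_top ENNReal.coe_ne_top (Lp.memLp f).2.ne) h
      simpa using this)

theorem schurOp_apply_ae (k : ℝ → ℝ → ℂ) (hk : IsSchurKernel k) (f : HalfL2) :
    schurOp k hk f =ᵐ[halfLine] fun x => ∫ y, k x y * f y ∂halfLine :=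
  MemLp.coeFn_toLp (schur_memLp hk f)

open Classical in
/-- The integral operator on `L²(ℝ₊)` with kernel `k`. It is used only for kernels satisfying
Schur's condition; for all others it is `0` by convention. -/
def intOp (k : ℝ → ℝ → ℂ) : HalfL2 →L[ℂ] HalfL2 :=
  if hk : IsSchurKernel k then schurOp k hk else 0

open Classical in
/-- Multiplication on `L²(ℝ₊)` by a real function `g`. It is used only for essentially bounded
measurable functions; for all others it is `0` by convention. -/
def mulOp (g : ℝ → ℝ) : HalfL2 →L[ℂ] HalfL2 :=
  if hg : MemLp (fun x => (g x : ℂ)) ⊤ halfLine then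
    (ContinuousLinearMap.mul ℂ ℂ).holderL halfLine ⊤ 2 2 (hg.toLp _)
  else 0

/-! ### The trace norm -/

/-- The trace norm of a bounded operator on a Hilbert space, with value `∞` if the operator is not
of trace class: the supremum of `∑ᵢ |⟨fᵢ, T eᵢ⟩|` over all pairs of finite orthonormal systems of
equal length. -/
def traceNorm {H : Type*} [NormedAddCommGroup H] [InnerProductSpace ℂ H] (T : H →L[ℂ] H) : ℝ≥0∞ :=
  ⨆ (n : ℕ) (e : Fin n → H) (f : Fin n → H) (_ : Orthonormal ℂ e) (_ : Orthonormal ℂ f),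
    ∑ i, ‖inner ℂ (f i) (T (e i))‖ₑ

/-! ### The resolvent kernels -/

/-- The resolvent kernel `K_ℝ(x, y; μ)` of `-d²/dx²` on the whole line. -/
def lineKernel (μ : ℝ) (x y : ℝ) : ℝ :=
  1 / (2 * μ) * Real.exp (-μ * |x - y|)

/-- The reflection coefficient `C(μ, θ)`. -/
def reflCoeff (μ θ : ℝ) : ℝ :=
  (μ * Real.sin θ + Real.cos θ) / (μ * Real.sin θ - Real.cos θ)

/-- The resolvent kernel `K_θ(x, y; μ)` of `-d²/dx²` on the half-line with the boundary condition
`cos θ · f(0) + sin θ · f'(0) = 0`. -/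
def robinKernel (θ μ : ℝ) (x y : ℝ) : ℝ :=
  1 / (2 * μ) * (Real.exp (-μ * |x - y|) + reflCoeff μ θ * Real.exp (-μ * (x + y)))

theorem integrable_exp_neg_abs_mul {μ : ℝ} (hμ : 0 < μ) :
    Integrable (fun t : ℝ => Real.exp (-μ * |t|)) := by
  rw [← integrableOn_univ, ← Set.Iic_union_Ioi (a := (0 : ℝ))]
  refine IntegrableOn.union ?_ ?_
  · refine (integrableOn_exp_mul_Iic hμ 0).congr_fun (fun t ht => ?_) measurableSet_Iic
    simp [abs_of_nonpos (Set.mem_Iic.1 ht)]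
  · refine (exp_neg_integrableOn_Ioi 0 hμ).congr_fun (fun t ht => ?_) measurableSet_Ioi
    simp [abs_of_pos (Set.mem_Ioi.1 ht)]

theorem isSchurKernel_of_exp_bound {k : ℝ → ℝ → ℂ} (hk : Measurable (Function.uncurry k))
    {c μ : ℝ} (hμ : 0 < μ)
    (h : ∀ x y, 0 < x → 0 < y → ‖k x y‖ ≤ c * Real.exp (-μ * |x - y|)) : IsSchurKernel k := by
  have hint : Integrable (fun t : ℝ => c * Real.exp (-μ * |t|)) :=
    (integrable_exp_neg_abs_mul hμ).const_mul c
  have hfin : ∫⁻ t : ℝ, ENNReal.ofReal (c * Real.exp (-μ * |t|)) ≠ ⊤ :=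
    hint.lintegral_lt_top.ne
  refine ⟨hk, (∫⁻ t : ℝ, ENNReal.ofReal (c * Real.exp (-μ * |t|))).toNNReal, ?_, ?_⟩
  · rw [ENNReal.coe_toNNReal hfin]
    filter_upwards [ae_restrict_mem measurableSet_Ioi] with x hx
    calc ∫⁻ y, ‖k x y‖ₑ ∂halfLine
        ≤ ∫⁻ y, ENNReal.ofReal (c * Real.exp (-μ * |x - y|)) ∂halfLine := by
          refine lintegral_mono_ae ?_
          filter_upwards [ae_restrict_mem measurableSet_Ioi] with y hy
          rw [← ofReal_norm]
          exact ENNReal.ofReal_le_ofReal (h x y hx hy)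
      _ ≤ ∫⁻ y, ENNReal.ofReal (c * Real.exp (-μ * |x - y|)) := setLIntegral_le_lintegral _ _
      _ = _ := lintegral_sub_left_eq_self
          (fun t : ℝ => ENNReal.ofReal (c * Real.exp (-μ * |t|))) x
  · rw [ENNReal.coe_toNNReal hfin]
    filter_upwards [ae_restrict_mem measurableSet_Ioi] with y hy
    calc ∫⁻ x, ‖k x y‖ₑ ∂halfLine
        ≤ ∫⁻ x, ENNReal.ofReal (c * Real.exp (-μ * |x - y|)) ∂halfLine := by
          refine lintegral_mono_ae ?_
          filter_upwards [ae_restrict_mem measurableSet_Ioi] with x hx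
          rw [← ofReal_norm]
          exact ENNReal.ofReal_le_ofReal (h x y hx hy)
      _ ≤ ∫⁻ x, ENNReal.ofReal (c * Real.exp (-μ * |x - y|)) := setLIntegral_le_lintegral _ _
      _ = _ := lintegral_sub_right_eq_self
          (fun t : ℝ => ENNReal.ofReal (c * Real.exp (-μ * |t|))) y

theorem isSchurKernel_robinKernel (θ : ℝ) {μ : ℝ} (hμ : 0 < μ) :
    IsSchurKernel (fun x y => (robinKernel θ μ x y : ℂ)) := by
  refine isSchurKernel_of_exp_bound (c := 1 / (2 * μ) * (1 + |reflCoeff μ θ|)) ?_ hμ ?_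
  · have : Measurable (fun p : ℝ × ℝ => robinKernel θ μ p.1 p.2) := by
      unfold robinKernel; fun_prop
    exact Complex.measurable_ofReal.comp this
  · intro x y hx hy
    rw [Complex.norm_real, Real.norm_eq_abs, robinKernel, abs_mul, abs_of_pos (by positivity),
      mul_assoc]
    gcongr
    have h2 : Real.exp (-μ * (x + y)) ≤ Real.exp (-μ * |x - y|) := by
      apply Real.exp_le_exp.2
      have : |x - y| ≤ x + y := abs_le.2 ⟨by linarith, by linarith⟩
      nlinarith
    calc _ ≤ |Real.exp (-μ * |x - y|)| + |reflCoeff μ θ * Real.exp (-μ * (x + y))| :=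
          abs_add_le _ _
      _ ≤ Real.exp (-μ * |x - y|) + |reflCoeff μ θ| * Real.exp (-μ * |x - y|) := by
          rw [abs_mul, abs_of_pos (Real.exp_pos _), abs_of_pos (Real.exp_pos _)]
          gcongr
      _ = _ := by ring

theorem isSchurKernel_lineKernel {μ : ℝ} (hμ : 0 < μ) :
    IsSchurKernel (fun x y => (lineKernel μ x y : ℂ)) := by
  refine isSchurKernel_of_exp_bound (c := 1 / (2 * μ)) ?_ hμ ?_
  · have : Measurable (fun p : ℝ × ℝ => lineKernel μ p.1 p.2) := by
      unfold lineKernel; fun_prop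
    exact Complex.measurable_ofReal.comp this
  · intro x y _ _
    rw [Complex.norm_real, Real.norm_eq_abs, lineKernel, abs_of_pos (by positivity)]

/-! ### Cutoff functions and the Neumann series terms -/

/-- The support of the restriction of `f` to the half-line `[0, ∞)`. -/
def halfSupport (f : ℝ → ℝ) : Set ℝ := closure {x | 0 ≤ x ∧ f x ≠ 0}

/-- A smooth cutoff function on `[0, ∞)`: it is identically one near `0` and has compact support
contained in `[0, 1)`. -/
structure IsCutoff (f : ℝ → ℝ) : Prop where
  smooth : ContDiffOn ℝ ∞ f (Set.Ici 0)
  eq_one : ∃ ε > 0, ∀ x ∈ Set.Ico 0 ε, f x = 1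
  supp : halfSupport f ⊆ Set.Ico 0 1

/-- The spectral parameter `μ ≥ 0` with `μ² = λ² V(0) + z²`. -/
def specParam (V : ℝ → ℝ) (l z : ℝ) : ℝ := √(l ^ 2 * V 0 + z ^ 2)

/-- The perturbation `λ(V, W) = λ² ψ (V - V(0)) + ψ W`. -/
def perturb (V W ψ : ℝ → ℝ) (l : ℝ) (x : ℝ) : ℝ :=
  l ^ 2 * (ψ x * (V x - V 0)) + ψ x * W x

theorem IsCutoff.eq_zero {f : ℝ → ℝ} (hf : IsCutoff f) {x : ℝ} (hx : 1 ≤ x) : f x = 0 := by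
  by_contra h
  exact absurd (hf.supp (subset_closure ⟨zero_le_one.trans hx, h⟩)).2 (not_lt.2 hx)

theorem IsCutoff.memLp_mul {f g : ℝ → ℝ} (hf : IsCutoff f)
    (hg : ContinuousOn g (Set.Icc 0 1)) :
    MemLp (fun x => ((f x * g x : ℝ) : ℂ)) ⊤ halfLine := by
  have hcont : ContinuousOn (fun x => ((f x * g x : ℝ) : ℂ)) (Set.Icc 0 1) :=
    Complex.continuous_ofReal.comp_continuousOn
      ((hf.smooth.continuousOn.mono fun x hx => hx.1).mul hg)
  have hzero : ∀ x, 1 < x → ((f x * g x : ℝ) : ℂ) = 0 := fun x hx => by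
    simp [hf.eq_zero hx.le]
  obtain ⟨C, hC⟩ := isCompact_Icc.exists_bound_of_continuousOn hcont
  refine memLp_top_of_bound ?_ (max C 0) ?_
  · have h : AEStronglyMeasurable (fun x => ((f x * g x : ℝ) : ℂ))
        (volume.restrict (Set.Icc 0 1 ∪ Set.Ioi 1)) := by
      rw [aestronglyMeasurable_union_iff]
      refine ⟨hcont.aestronglyMeasurable measurableSet_Icc, ?_⟩
      refine (aestronglyMeasurable_const (b := (0 : ℂ))).congr ?_
      filter_upwards [ae_restrict_mem measurableSet_Ioi] with x hx
      exact (hzero x hx).symm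
    refine h.mono_measure (Measure.restrict_mono_set _ fun x hx => ?_)
    rcases le_or_gt x 1 with h1 | h1
    · exact Or.inl ⟨le_of_lt hx, h1⟩
    · exact Or.inr h1
  · filter_upwards [ae_restrict_mem measurableSet_Ioi] with x hx
    rcases le_or_gt x 1 with h1 | h1
    · exact (hC x ⟨le_of_lt hx, h1⟩).trans (le_max_left _ _)
    · rw [hzero x h1]; simp

theorem IsCutoff.memLp {f : ℝ → ℝ} (hf : IsCutoff f) :
    MemLp (fun x => (f x : ℂ)) ⊤ halfLine := by
  simpa using hf.memLp_mul (g := fun _ => 1) continuousOn_const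

theorem memLp_perturb {V W ψ : ℝ → ℝ} (hψ : IsCutoff ψ) (hV : ContinuousOn V (Set.Icc 0 1))
    (hW : ContinuousOn W (Set.Icc 0 1)) (l : ℝ) :
    MemLp (fun x => (perturb V W ψ l x : ℂ)) ⊤ halfLine := by
  have h := hψ.memLp_mul (g := fun x => l ^ 2 * (V x - V 0) + W x)
    ((continuousOn_const.mul (hV.sub continuousOn_const)).add hW)
  convert h using 3 with x
  rw [perturb]
  ring

/-- The term `R^{0N}_∂ = (-1)^N ψ ([K_θ λ(V,W)]^N K_θ - [K_ℝ λ(V,W)]^N K_ℝ) φ`, an operator on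
`L²(ℝ₊)` depending on the parameters `λ = l` and `z`; products are compositions of operators. -/
def neumannTerm (θ : ℝ) (V W φ ψ : ℝ → ℝ) (N : ℕ) (l z : ℝ) : HalfL2 →L[ℂ] HalfL2 :=
  let Kθ := intOp fun x y => (robinKernel θ (specParam V l z) x y : ℂ)
  let Kℝ := intOp fun x y => (lineKernel (specParam V l z) x y : ℂ)
  let Λ := mulOp (perturb V W ψ l)
  (-1 : ℂ) ^ N • (mulOp ψ * ((Kθ * Λ) ^ N * Kθ - (Kℝ * Λ) ^ N * Kℝ) * mulOp φ)

/-- The mixed derivative `∂_λ^γ ∂_z^ν F` at `(l, z)` of an operator family, taken with respect to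
the operator norm. -/
def mixedDeriv (γ ν : ℕ) (F : ℝ → ℝ → HalfL2 →L[ℂ] HalfL2) (l z : ℝ) : HalfL2 →L[ℂ] HalfL2 :=
  iteratedDeriv γ (fun l' => iteratedDeriv ν (fun z' => F l' z') z) l

end

noncomputable section

/-! ### Multiplication operators -/

/-! Write `A`, `B` for the Robin and line resolvents and `L` for the perturbation. The family
extends holomorphically to complex parameters in a bidisc of radius `ε * μ` around a real point,
with `ε = bidiscScale (V 0)`. A trace norm bound for the undifferentiated terms there gives all
derivatives by Cauchy's estimate, each derivative gaining a factor `1 / μ`.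

The undifferentiated bound (`traceLe_neumann`) starts from the telescoping identity
`mul_pow_mul_sub_eq_sum`, which writes the difference as the sum over `j ≤ N` of `(A L) ^ j (A - B)
(L B) ^ (N - j)`. The kernel of `A - B` is a multiple of `exp (-m (x + y))`, so it has rank one and
keeps rank one after a weight `exp (-μ x / 2)` is split off on each side. That weight is a product
of `M` equal weights `exp (-δ x)`. A weight passes through a resolvent by conjugation, since the
kernel decays at rate `Re m > μ / 2`. When it meets `L`, it uses that `V - V 0` vanishes at the
origin: `x exp (-δ x) ≤ 1 / δ`, so `L` costs `O(μ)` in place of `O(μ ^ 2)`. Each of `M` factors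
among the `N` thus gains `1 / μ`, and the other `N - M` are bounded by `3 / 4`. The rank one
operator contributes `1 / μ ^ 2`, whence `(N + 1) (3 / 4) ^ (N - M) μ ^ (-M - 2)` up to a constant,
half a power better than required.

The tail of the series is treated as a single holomorphic function: it has a closed form through `(1
+ K L)⁻¹` (`neumannTail`), its trace norm is bounded by summing the bounds of the terms, and
Cauchy's estimate is applied to the sum. -/

theorem mulOp_apply_ae {g : ℝ → ℝ} (hg : MemLp (fun x => (g x : ℂ)) ⊤ halfLine) (f : HalfL2) :
    mulOp g f =ᵐ[halfLine] fun x => (g x : ℂ) * f x := by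
  rw [mulOp, dif_pos hg]
  have h : (ContinuousLinearMap.mul ℂ ℂ).holderL halfLine ⊤ 2 2 (hg.toLp _) f
      = (ContinuousLinearMap.mul ℂ ℂ).holder 2 (hg.toLp _) f := rfl
  rw [h]
  filter_upwards [(ContinuousLinearMap.mul ℂ ℂ).coeFn_holder (r := 2) (hg.toLp _) f,
    hg.coeFn_toLp] with x hx hx'
  rw [hx, hx']
  rfl

theorem norm_mulOp_le {g : ℝ → ℝ} (hg : MemLp (fun x => (g x : ℂ)) ⊤ halfLine) {c : ℝ}
    (hc : 0 ≤ c) (h : ∀ x, 0 < x → |g x| ≤ c) : ‖mulOp g‖ ≤ c := by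
  refine ContinuousLinearMap.opNorm_le_bound _ hc fun f => ?_
  refine Lp.norm_le_mul_norm_of_ae_le_mul ?_
  filter_upwards [mulOp_apply_ae hg f, ae_restrict_mem measurableSet_Ioi] with x hx hx0
  rw [hx, norm_mul, Complex.norm_real, Real.norm_eq_abs]
  gcongr
  exact h x hx0

theorem mulOp_mul_mulOp {g h k : ℝ → ℝ} (hg : MemLp (fun x => (g x : ℂ)) ⊤ halfLine)
    (hh : MemLp (fun x => (h x : ℂ)) ⊤ halfLine) (hk : MemLp (fun x => (k x : ℂ)) ⊤ halfLine)
    (e : ∀ x, 0 < x → g x * h x = k x) : mulOp g * mulOp h = mulOp k := by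
  ext1 f
  refine Lp.ext ?_
  rw [mul_apply_eq_comp]
  filter_upwards [mulOp_apply_ae hg (mulOp h f), mulOp_apply_ae hh f, mulOp_apply_ae hk f,
    ae_restrict_mem measurableSet_Ioi] with x h1 h2 h3 hx
  rw [h1, h2, h3, ← e x hx]
  push_cast
  ring

theorem mulOp_linear_combination {a b g : ℝ → ℝ} {s : ℝ}
    (ha : MemLp (fun x => (a x : ℂ)) ⊤ halfLine) (hb : MemLp (fun x => (b x : ℂ)) ⊤ halfLine)
    (hg : MemLp (fun x => (g x : ℂ)) ⊤ halfLine) (e : ∀ x, g x = s * a x + b x) :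
    mulOp g = (s : ℂ) • mulOp a + mulOp b := by
  ext1 f
  refine Lp.ext ?_
  rw [_root_.add_apply, _root_.smul_apply]
  filter_upwards [mulOp_apply_ae ha f, mulOp_apply_ae hb f, mulOp_apply_ae hg f,
    Lp.coeFn_add ((s : ℂ) • mulOp a f) (mulOp b f), Lp.coeFn_smul (s : ℂ) (mulOp a f)]
    with x h1 h2 h3 h4 h5
  rw [h4, Pi.add_apply, h5, Pi.smul_apply, h1, h2, h3, e]
  push_cast
  rw [smul_eq_mul]
  ring

/-! ### Integral operators -/

theorem intOp_apply_ae {k : ℝ → ℝ → ℂ} (hk : IsSchurKernel k) (f : HalfL2) :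
    intOp k f =ᵐ[halfLine] fun x => ∫ y, k x y * f y ∂halfLine := by
  rw [intOp, dif_pos hk]
  exact schurOp_apply_ae k hk f

theorem norm_intOp_le {k : ℝ → ℝ → ℂ} (hm : Measurable (Function.uncurry k)) {C : ℝ≥0}
    (h1 : ∀ᵐ x ∂halfLine, ∫⁻ y, ‖k x y‖ₑ ∂halfLine ≤ C)
    (h2 : ∀ᵐ y ∂halfLine, ∫⁻ x, ‖k x y‖ₑ ∂halfLine ≤ C) : ‖intOp k‖ ≤ C := by
  have hk : IsSchurKernel k := ⟨hm, C, h1, h2⟩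
  refine ContinuousLinearMap.opNorm_le_bound _ C.2 fun f => ?_
  rw [Lp.norm_def, Lp.norm_def, eLpNorm_congr_ae (intOp_apply_ae hk f)]
  have := ENNReal.toReal_mono
    (ENNReal.mul_ne_top ENNReal.coe_ne_top (Lp.memLp f).2.ne) (schur_eLpNorm_le hm h1 h2 f)
  simpa using this

theorem lintegral_exp_neg_abs_mul {c σ : ℝ} (hc : 0 ≤ c) (hσ : 0 < σ) :
    ∫⁻ t : ℝ, ENNReal.ofReal (c * Real.exp (-σ * |t|)) = ENNReal.ofReal (2 * c / σ) := by
  rw [← ofReal_integral_eq_lintegral_ofReal ((integrable_exp_neg_abs_mul hσ).const_mul c)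
    (Filter.Eventually.of_forall fun t => by positivity), integral_const_mul]
  congr 1
  have : ∫ t : ℝ, Real.exp (-σ * |t|) = 2 * ∫ t in Set.Ioi (0 : ℝ), Real.exp (-σ * t) :=
    integral_comp_abs (f := fun t => Real.exp (-σ * t))
  rw [this, integral_exp_mul_Ioi (by linarith)]
  simp
  field_simp

/-- Schur's test: rows and columns are dominated by translates of `c * exp (-σ |t|)`, whose integral
over the whole line is `2 * c / σ`. -/
theorem norm_intOp_le_of_exp_bound {k : ℝ → ℝ → ℂ} (hk : Measurable (Function.uncurry k))
    {c σ : ℝ} (hc : 0 ≤ c) (hσ : 0 < σ)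
    (h : ∀ x y, 0 < x → 0 < y → ‖k x y‖ ≤ c * Real.exp (-σ * |x - y|)) :
    ‖intOp k‖ ≤ 2 * c / σ := by
  have h0 : 0 ≤ 2 * c / σ := by positivity
  have key : ∀ g : ℝ → ℝ, (∀ u : ℝ → ℝ≥0∞, ∫⁻ t, u (g t) = ∫⁻ t, u t) → ∀ v : ℝ → ℂ,
      (∀ t, 0 < t → ‖v t‖ ≤ c * Real.exp (-σ * |g t|)) →
      ∫⁻ t, ‖v t‖ₑ ∂halfLine ≤ ((2 * c / σ).toNNReal : ℝ≥0∞) := by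
    intro g hg v hv
    calc ∫⁻ t, ‖v t‖ₑ ∂halfLine
        ≤ ∫⁻ t, ENNReal.ofReal (c * Real.exp (-σ * |g t|)) ∂halfLine := by
          refine lintegral_mono_ae ?_
          filter_upwards [ae_restrict_mem measurableSet_Ioi] with t ht
          rw [← ofReal_norm]
          exact ENNReal.ofReal_le_ofReal (hv t ht)
      _ ≤ ∫⁻ t, ENNReal.ofReal (c * Real.exp (-σ * |g t|)) := setLIntegral_le_lintegral _ _
      _ = _ := hg fun t => ENNReal.ofReal (c * Real.exp (-σ * |t|))
      _ = _ := lintegral_exp_neg_abs_mul hc hσ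
  have hle := norm_intOp_le hk (C := (2 * c / σ).toNNReal) ?_ ?_
  · simpa [Real.coe_toNNReal _ h0] using hle
  · filter_upwards [ae_restrict_mem measurableSet_Ioi] with x hx
    exact key (fun t => x - t) (fun u => lintegral_sub_left_eq_self u x) _ fun t ht => h x t hx ht
  · filter_upwards [ae_restrict_mem measurableSet_Ioi] with y hy
    exact key (fun t => t - y) (fun u => lintegral_sub_right_eq_self u y) _
      fun t ht => h t y ht hy

theorem IsSchurKernel.linear_combination {a b : ℝ → ℝ → ℂ} (ha : IsSchurKernel a)
    (hb : IsSchurKernel b) (s t : ℂ) : IsSchurKernel fun x y => s * a x y + t * b x y := by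
  obtain ⟨ma, A, a1, a2⟩ := ha
  obtain ⟨mb, B, b1, b2⟩ := hb
  have key : ∀ u v : ℝ → ℂ, Measurable u → Measurable v → ∫⁻ y, ‖u y‖ₑ ∂halfLine ≤ A →
      ∫⁻ y, ‖v y‖ₑ ∂halfLine ≤ B →
      ∫⁻ y, ‖s * u y + t * v y‖ₑ ∂halfLine ≤ ((‖s‖₊ * A + ‖t‖₊ * B : ℝ≥0) : ℝ≥0∞) := by
    intro u v hu hv h1 h2
    refine (lintegral_mono fun y => enorm_add_le _ _).trans ?_
    rw [lintegral_add_right _ (hv.const_mul t).enorm]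
    simp only [enorm_mul]
    rw [lintegral_const_mul _ hu.enorm, lintegral_const_mul _ hv.enorm]
    push_cast
    exact add_le_add (mul_le_mul_right h1 _) (mul_le_mul_right h2 _)
  refine ⟨(ma.const_mul s).add (mb.const_mul t), ‖s‖₊ * A + ‖t‖₊ * B, ?_, ?_⟩
  · filter_upwards [a1, b1] with x h1 h2
    exact key _ _ (ma.of_uncurry_left (x := x)) (mb.of_uncurry_left (x := x)) h1 h2
  · filter_upwards [a2, b2] with y h1 h2
    exact key _ _ (ma.of_uncurry_right (y := y)) (mb.of_uncurry_right (y := y)) h1 h2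

theorem intOp_linear_combination {a b k : ℝ → ℝ → ℂ} (s t : ℂ)
    (ha : IsSchurKernel a) (hb : IsSchurKernel b) (hk : IsSchurKernel k)
    (e : ∀ x y, 0 < x → 0 < y → k x y = s * a x y + t * b x y) :
    intOp k = s • intOp a + t • intOp b := by
  ext1 f
  refine Lp.ext ?_
  rw [_root_.add_apply, _root_.smul_apply,
    _root_.smul_apply]
  filter_upwards [intOp_apply_ae ha f, intOp_apply_ae hb f, intOp_apply_ae hk f,
    Lp.coeFn_add (s • intOp a f) (t • intOp b f), Lp.coeFn_smul s (intOp a f),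
    Lp.coeFn_smul t (intOp b f), schur_integrable ha f, schur_integrable hb f,
    ae_restrict_mem measurableSet_Ioi] with x h1 h2 h3 h4 h5 h6 h7 h8 hx
  rw [h4, Pi.add_apply, h5, h6, Pi.smul_apply, Pi.smul_apply, h1, h2, h3, smul_eq_mul,
    smul_eq_mul, ← integral_const_mul, ← integral_const_mul,
    ← integral_add (h7.const_mul s) (h8.const_mul t)]
  refine integral_congr_ae ?_
  filter_upwards [ae_restrict_mem measurableSet_Ioi] with y hy
  rw [e x y hx hy]
  ring

theorem intOp_mul_mulOp_comm {k k' : ℝ → ℝ → ℂ} (hk : IsSchurKernel k) (hk' : IsSchurKernel k')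
    {g : ℝ → ℝ} (hg : MemLp (fun x => (g x : ℂ)) ⊤ halfLine)
    (e : ∀ x y, 0 < x → 0 < y → k x y * g y = g x * k' x y) :
    intOp k * mulOp g = mulOp g * intOp k' := by
  ext1 f
  refine Lp.ext ?_
  rw [mul_apply_eq_comp, mul_apply_eq_comp]
  filter_upwards [intOp_apply_ae hk (mulOp g f), mulOp_apply_ae hg (intOp k' f),
    intOp_apply_ae hk' f, ae_restrict_mem measurableSet_Ioi] with x h1 h2 h3 hx
  rw [h1, h2, h3, ← integral_const_mul]
  refine integral_congr_ae ?_
  filter_upwards [mulOp_apply_ae hg f, ae_restrict_mem measurableSet_Ioi] with y h4 hy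
  rw [h4, ← mul_assoc, e x y hx hy]
  ring

/-! ### Exponential kernels -/

theorem memLp_exp_neg {t : ℝ} (ht : 0 ≤ t) :
    MemLp (fun x => ((Real.exp (-t * x) : ℝ) : ℂ)) ⊤ halfLine := by
  refine memLp_top_of_bound (by fun_prop) 1 ?_
  filter_upwards [ae_restrict_mem measurableSet_Ioi] with x hx
  have hx : 0 < x := hx
  rw [Complex.norm_real, Real.norm_eq_abs, Real.abs_exp, Real.exp_le_one_iff]
  nlinarith

/-- Conjugation of an exponentially decaying integral operator by an exponential weight. -/
theorem exists_intOp_conj {k : ℝ → ℝ → ℂ} (hk : Measurable (Function.uncurry k)) {c σ s : ℝ}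
    (hc : 0 ≤ c) (hs : |s| < σ)
    (h : ∀ x y, 0 < x → 0 < y → ‖k x y‖ ≤ c * Real.exp (-σ * |x - y|)) :
    ∃ k' : ℝ → ℝ → ℂ, IsSchurKernel k' ∧ (∀ x y, k' x y = Real.exp (s * (x - y)) * k x y) ∧
      ‖intOp k'‖ ≤ 2 * c / (σ - |s|) := by
  have hm : Measurable (Function.uncurry fun x y => (Real.exp (s * (x - y)) : ℂ) * k x y) := by
    refine Measurable.mul ?_ hk
    fun_prop
  have hb : ∀ x y, 0 < x → 0 < y → ‖(Real.exp (s * (x - y)) : ℂ) * k x y‖ ≤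
      c * Real.exp (-(σ - |s|) * |x - y|) := by
    intro x y hx hy
    rw [norm_mul, Complex.norm_real, Real.norm_eq_abs, Real.abs_exp]
    calc Real.exp (s * (x - y)) * ‖k x y‖
        ≤ Real.exp (|s| * |x - y|) * (c * Real.exp (-σ * |x - y|)) := by
          refine mul_le_mul (Real.exp_le_exp.2 ?_) (h x y hx hy) (norm_nonneg _) (Real.exp_pos _).le
          rw [← abs_mul]
          exact le_abs_self _
      _ = _ := by
          rw [mul_left_comm, ← Real.exp_add]
          ring_nf
  exact ⟨_, isSchurKernel_of_exp_bound hm (sub_pos.2 hs) hb, fun _ _ => rfl,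
    norm_intOp_le_of_exp_bound hm hc (sub_pos.2 hs) hb⟩

/-- Pulling the weight to the left multiplies the kernel by `exp (t (x - y))`, which only lowers the
decay rate from `σ` to `σ - t`. -/
theorem exists_intOp_mul_exp {k : ℝ → ℝ → ℂ} (hk : Measurable (Function.uncurry k)) {c σ t : ℝ}
    (hc : 0 ≤ c) (ht : 0 ≤ t) (hs : t < σ)
    (h : ∀ x y, 0 < x → 0 < y → ‖k x y‖ ≤ c * Real.exp (-σ * |x - y|)) :
    ∃ K : HalfL2 →L[ℂ] HalfL2, intOp k * mulOp (fun x => Real.exp (-t * x)) =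
      mulOp (fun x => Real.exp (-t * x)) * K ∧ ‖K‖ ≤ 2 * c / (σ - t) := by
  obtain ⟨k', h1, h2, h3⟩ := exists_intOp_conj hk hc (s := t) (by rwa [abs_of_nonneg ht]) h
  rw [abs_of_nonneg ht] at h3
  refine ⟨_, intOp_mul_mulOp_comm (isSchurKernel_of_exp_bound hk (ht.trans_lt hs) h) h1
    (memLp_exp_neg ht) fun x y _ _ => ?_, h3⟩
  have : Real.exp (-t * y) = Real.exp (-t * x) * Real.exp (t * (x - y)) := by
    rw [← Real.exp_add]; ring_nf
  rw [h2, this]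
  push_cast
  ring

theorem exists_exp_mul_intOp {k : ℝ → ℝ → ℂ} (hk : Measurable (Function.uncurry k)) {c σ t : ℝ}
    (hc : 0 ≤ c) (ht : 0 ≤ t) (hs : t < σ)
    (h : ∀ x y, 0 < x → 0 < y → ‖k x y‖ ≤ c * Real.exp (-σ * |x - y|)) :
    ∃ K : HalfL2 →L[ℂ] HalfL2, mulOp (fun x => Real.exp (-t * x)) * intOp k =
      K * mulOp (fun x => Real.exp (-t * x)) ∧ ‖K‖ ≤ 2 * c / (σ - t) := by
  obtain ⟨k', h1, h2, h3⟩ := exists_intOp_conj hk hc (s := -t) (by rwa [abs_neg, abs_of_nonneg ht]) h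
  rw [abs_neg, abs_of_nonneg ht] at h3
  refine ⟨_, (intOp_mul_mulOp_comm h1 (isSchurKernel_of_exp_bound hk (ht.trans_lt hs) h)
    (memLp_exp_neg ht) fun x y _ _ => ?_).symm, h3⟩
  have : Real.exp (-t * x) = Real.exp (-t * y) * Real.exp (-t * (x - y)) := by
    rw [← Real.exp_add]; ring_nf
  rw [h2, this]
  push_cast
  ring

/-- The integral operator with kernel `exp (-m * d x y)`. -/
def expOp (d : ℝ → ℝ → ℝ) (m : ℂ) : HalfL2 →L[ℂ] HalfL2 :=
  intOp fun x y => Complex.exp (-m * d x y)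

theorem measurable_expKernel {d : ℝ → ℝ → ℝ} (hd : Measurable (Function.uncurry d)) (m : ℂ) :
    Measurable (Function.uncurry fun x y => Complex.exp (-m * d x y)) :=
  Complex.measurable_exp.comp ((Complex.measurable_ofReal.comp hd).const_mul (-m))

theorem norm_expKernel_le {d : ℝ → ℝ → ℝ} (hd : ∀ x y, 0 < x → 0 < y → |x - y| ≤ d x y) {m : ℂ}
    (hm : 0 < m.re) (x y : ℝ) (hx : 0 < x) (hy : 0 < y) :
    ‖Complex.exp (-m * d x y)‖ ≤ 1 * Real.exp (-m.re * |x - y|) := by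
  rw [Complex.norm_exp, one_mul]
  refine Real.exp_le_exp.2 ?_
  simp only [Complex.mul_re, Complex.neg_re, Complex.ofReal_re, Complex.neg_im, Complex.ofReal_im,
    mul_zero, sub_zero]
  nlinarith [hd x y hx hy]

theorem isSchurKernel_exp {d : ℝ → ℝ → ℝ} (hdm : Measurable (Function.uncurry d))
    (hd : ∀ x y, 0 < x → 0 < y → |x - y| ≤ d x y) {m : ℂ} (hm : 0 < m.re) :
    IsSchurKernel fun x y => Complex.exp (-m * d x y) :=
  isSchurKernel_of_exp_bound (measurable_expKernel hdm m) hm (norm_expKernel_le hd hm)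

theorem norm_expOp_le {d : ℝ → ℝ → ℝ} (hdm : Measurable (Function.uncurry d))
    (hd : ∀ x y, 0 < x → 0 < y → |x - y| ≤ d x y) {m : ℂ} (hm : 0 < m.re) :
    ‖expOp d m‖ ≤ 2 / m.re :=
  (norm_intOp_le_of_exp_bound (measurable_expKernel hdm m) zero_le_one hm
    (norm_expKernel_le hd hm)).trans_eq (by rw [mul_one])

theorem norm_exp_sub_one_sub_le (w : ℂ) :
    ‖Complex.exp w - 1 - w‖ ≤ ‖w‖ ^ 2 * Real.exp ‖w‖ := by
  have := Complex.norm_exp_sub_sum_le_norm_mul_exp w 2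
  simpa [Finset.sum_range_succ, sub_sub] using this

theorem pow_mul_exp_neg_le {s t : ℝ} (hs : 0 < s) (ht : 0 ≤ t) (n : ℕ) :
    t ^ n * Real.exp (-s * t) ≤ n.factorial / s ^ n := by
  have h := Real.pow_div_factorial_le_exp (s * t) (by positivity) n
  rw [neg_mul, Real.exp_neg, ← div_eq_mul_inv, div_le_div_iff₀ (Real.exp_pos _) (by positivity)]
  rw [div_le_iff₀ (by positivity), mul_pow] at h
  linarith

/-- Differentiation under the kernel: the second order Taylor remainder in `m` is again an
exponentially decaying kernel, of size `O(‖h‖ ^ 2)`. -/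
theorem hasDerivAt_expOp {d : ℝ → ℝ → ℝ} (hdm : Measurable (Function.uncurry d))
    (hd : ∀ x y, 0 < x → 0 < y → |x - y| ≤ d x y) {m : ℂ} (hm : 0 < m.re) :
    HasDerivAt (expOp d) (intOp fun x y => -(d x y : ℂ) * Complex.exp (-m * d x y)) m := by
  have hre : ∀ x y, (-m * d x y).re = -m.re * d x y := by intro x y; simp
  have hd' : ∀ x y, 0 < x → 0 < y → 0 ≤ d x y := fun x y hx hy => (abs_nonneg _).trans (hd x y hx hy)
  set D : ℝ → ℝ → ℂ := fun x y => -(d x y : ℂ) * Complex.exp (-m * d x y) with hD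
  have hDm : Measurable (Function.uncurry D) :=
    (Complex.measurable_ofReal.comp hdm).neg.mul (measurable_expKernel hdm m)
  have hDs : IsSchurKernel D := by
    refine isSchurKernel_of_exp_bound (c := (1 : ℕ).factorial / (m.re / 2) ^ 1) (μ := m.re / 2)
      hDm (by positivity) fun x y hx hy => ?_
    have h1 := pow_mul_exp_neg_le (s := m.re / 2) (by positivity) (hd' x y hx hy) 1
    have h2 := hd x y hx hy
    rw [hD, norm_mul, norm_neg, Complex.norm_real, Real.norm_eq_abs, abs_of_nonneg (hd' x y hx hy),
      Complex.norm_exp, hre]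
    calc d x y * Real.exp (-m.re * d x y)
        = (d x y ^ 1 * Real.exp (-(m.re / 2) * d x y)) * Real.exp (-(m.re / 2) * d x y) := by
          rw [mul_assoc, ← Real.exp_add, pow_one]; ring_nf
      _ ≤ _ := by
          gcongr ?_ * ?_
          exact Real.exp_le_exp.2 (by nlinarith)
  have hs0 : 0 < m.re / 4 := by positivity
  -- The decay rate `m.re` is split in three: a quarter absorbs `exp (‖h‖ d)`, a quarter absorbs `d
  -- ^ 2`, and the remaining half feeds Schur's test.
  have key : ∀ h : ℂ, ‖h‖ ≤ m.re / 4 →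
      ‖expOp d (m + h) - expOp d m - h • intOp D‖ ≤ 2 * (2 / (m.re / 4) ^ 2) / (m.re / 2) * ‖h‖ ^ 2 := by
    intro h hh
    have hpos : 0 < (m + h).re := by
      have := Complex.abs_re_le_norm h
      have := neg_abs_le h.re
      rw [Complex.add_re]; linarith
    set R : ℝ → ℝ → ℂ := fun x y =>
      Complex.exp (-m * d x y) * (Complex.exp (-h * d x y) - 1 - -h * d x y) with hR
    have hRm : Measurable (Function.uncurry R) :=
      (measurable_expKernel hdm m).mul (((measurable_expKernel hdm h).sub_const 1).sub
        ((Complex.measurable_ofReal.comp hdm).const_mul (-h)))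
    have hRb : ∀ x y, 0 < x → 0 < y →
        ‖R x y‖ ≤ ‖h‖ ^ 2 * (2 / (m.re / 4) ^ 2) * Real.exp (-(m.re / 2) * |x - y|) := by
      intro x y hx hy
      have h0 := hd' x y hx hy
      have h1 := pow_mul_exp_neg_le (s := m.re / 4) (by positivity) h0 2
      have h2 := norm_exp_sub_one_sub_le (-h * d x y)
      have h3 : ‖-h * d x y‖ = ‖h‖ * d x y := by
        rw [norm_mul, norm_neg, Complex.norm_real, Real.norm_eq_abs, abs_of_nonneg h0]
      rw [h3] at h2
      rw [hR, norm_mul, Complex.norm_exp, hre]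
      calc Real.exp (-m.re * d x y) * ‖Complex.exp (-h * d x y) - 1 - -h * d x y‖
          ≤ Real.exp (-m.re * d x y) * ((‖h‖ * d x y) ^ 2 * Real.exp (m.re / 4 * d x y)) := by
            gcongr
            exact h2.trans (by gcongr)
        _ = ‖h‖ ^ 2 * (d x y ^ 2 * Real.exp (-(m.re / 4) * d x y)) *
            Real.exp (-(m.re / 2) * d x y) := by
            have : Real.exp (-(m.re / 4) * d x y) * Real.exp (-(m.re / 2) * d x y) =
              Real.exp (-m.re * d x y) * Real.exp (m.re / 4 * d x y) := by
                rw [← Real.exp_add, ← Real.exp_add]; ring_nf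
            linear_combination (‖h‖ ^ 2 * d x y ^ 2) * -this
        _ ≤ _ := by
            refine mul_le_mul ?_ ?_ (Real.exp_pos _).le (by positivity)
            · refine mul_le_mul_of_nonneg_left (h1.trans_eq (by norm_num)) (by positivity)
            · exact Real.exp_le_exp.2 (by nlinarith [hd x y hx hy])
    have hRs := isSchurKernel_of_exp_bound hRm (by positivity) hRb
    have hQ := (isSchurKernel_exp hdm hd hm).linear_combination hDs 1 h
    have e1 := intOp_linear_combination 1 h (isSchurKernel_exp hdm hd hm) hDs hQ
      fun _ _ _ _ => rfl
    have e2 := intOp_linear_combination 1 1 hQ hRs (isSchurKernel_exp hdm hd hpos)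
      fun x y _ _ => by
        have : Complex.exp (-(m + h) * d x y) =
            Complex.exp (-m * d x y) * Complex.exp (-h * d x y) := by
          rw [← Complex.exp_add]; ring_nf
        rw [this, hD, hR]
        ring
    have e3 : expOp d (m + h) - expOp d m - h • intOp D = intOp R := by
      rw [expOp, e2, e1, one_smul, one_smul, one_smul, expOp]
      abel
    rw [e3]
    refine (norm_intOp_le_of_exp_bound hRm (by positivity) (by positivity) hRb).trans_eq ?_
    ring
  rw [hasDerivAt_iff_isLittleO_nhds_zero]
  refine Asymptotics.IsBigO.trans_isLittleO (g := fun h : ℂ => h ^ 2) ?_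
    (Asymptotics.isLittleO_pow_id one_lt_two)
  refine Asymptotics.IsBigO.of_bound (2 * (2 / (m.re / 4) ^ 2) / (m.re / 2)) ?_
  filter_upwards [Metric.closedBall_mem_nhds (0 : ℂ) hs0] with h hh
  rw [norm_pow]
  exact key h (by simpa using hh)

/-- Complex differentiability on the open right half-plane already gives every order of smoothness.
-/
theorem contDiffAt_expOp {d : ℝ → ℝ → ℝ} (hdm : Measurable (Function.uncurry d))
    (hd : ∀ x y, 0 < x → 0 < y → |x - y| ≤ d x y) {m : ℂ} (hm : 0 < m.re) {n : WithTop ℕ∞} :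
    ContDiffAt ℂ n (expOp d) m := by
  have ho : IsOpen {m : ℂ | 0 < m.re} := isOpen_lt continuous_const Complex.continuous_re
  have : DifferentiableOn ℂ (expOp d) {m : ℂ | 0 < m.re} := fun m hm =>
    (hasDerivAt_expOp hdm hd hm).differentiableAt.differentiableWithinAt
  exact (this.contDiffOn ho).contDiffAt (ho.mem_nhds hm)

/-! ### The rank one kernel `exp (-m (x + y))` -/

theorem memLp_two_exp {m : ℂ} (hm : 0 < m.re) :
    MemLp (fun x : ℝ => Complex.exp (-m * x)) 2 halfLine := by
  rw [memLp_two_iff_integrable_sq_norm (by fun_prop)]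
  have := exp_neg_integrableOn_Ioi 0 (b := 2 * m.re) (by positivity)
  refine Integrable.congr this (Filter.Eventually.of_forall fun x => ?_)
  simp only [Complex.norm_exp, ← Real.exp_nat_mul]
  congr 1
  simp
  ring

/-- The function `exp (-m x)` as an element of `L²(ℝ₊)`. -/
def expVec (m : ℂ) (hm : 0 < m.re) : HalfL2 := (memLp_two_exp hm).toLp _

theorem expVec_ae (m : ℂ) (hm : 0 < m.re) :
    expVec m hm =ᵐ[halfLine] fun x => Complex.exp (-m * x) := (memLp_two_exp hm).coeFn_toLp

theorem norm_expVec_sq (m : ℂ) (hm : 0 < m.re) : ‖expVec m hm‖ ^ 2 = 1 / (2 * m.re) := by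
  have h := L2.inner_def (𝕜 := ℂ) (expVec m hm) (expVec m hm)
  rw [inner_self_eq_norm_sq_to_K] at h
  have h2 : ∫ x, inner ℂ (expVec m hm x) (expVec m hm x) ∂halfLine =
      ∫ x, ((Real.exp (-(2 * m.re) * x) : ℝ) : ℂ) ∂halfLine := by
    refine integral_congr_ae ?_
    filter_upwards [expVec_ae m hm] with x hx
    rw [hx, inner_self_eq_norm_sq_to_K, Complex.norm_exp]
    simp only [Complex.coe_algebraMap, ← Complex.ofReal_pow, ← Real.exp_nat_mul]
    congr 2
    simp
    ring
  rw [h2, integral_complex_ofReal, integral_exp_mul_Ioi (by linarith)] at h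
  have h3 : ‖expVec m hm‖ ^ 2 = -Real.exp (-(2 * m.re) * 0) / -(2 * m.re) := by
    exact Complex.ofReal_injective (by rw [Complex.ofReal_pow]; exact h)
  rw [h3]
  simp

/-- The kernel factors as `exp (-m x) * exp (-m y)`; the conjugate parameter undoes the conjugation
in the first slot of the inner product. -/
theorem expOp_add_eq_rankOne {m : ℂ} (hm : 0 < m.re) :
    expOp (fun x y => x + y) m =
      InnerProductSpace.rankOne ℂ (expVec m hm) (expVec (starRingEnd ℂ m) (by simpa using hm)) := by
  have hs : IsSchurKernel fun x y => Complex.exp (-m * (x + y : ℝ)) :=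
    isSchurKernel_exp (by fun_prop) (fun x y hx hy => abs_le.2 ⟨by linarith, by linarith⟩) hm
  have hm' : 0 < (starRingEnd ℂ m).re := by simpa using hm
  ext1 f
  refine Lp.ext ?_
  rw [InnerProductSpace.rankOne_apply]
  filter_upwards [intOp_apply_ae hs f, expVec_ae m hm,
    Lp.coeFn_smul (inner ℂ (expVec (starRingEnd ℂ m) hm') f) (expVec m hm)] with x h1 h2 h3
  rw [h3, Pi.smul_apply, h2, expOp, h1, smul_eq_mul, L2.inner_def, ← integral_mul_const]
  refine integral_congr_ae ?_
  filter_upwards [expVec_ae _ hm'] with y h4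
  rw [h4, RCLike.inner_apply, ← Complex.exp_conj]
  simp only [map_mul, map_neg, Complex.conj_conj, Complex.conj_ofReal]
  have : Complex.exp (-m * (x + y : ℝ)) = Complex.exp (-m * x) * Complex.exp (-m * y) := by
    rw [← Complex.exp_add]
    push_cast
    ring_nf
  rw [this]
  ring

theorem norm_expVec_mul_norm_expVec_conj {m : ℂ} (hm : 0 < m.re)
    (hm' : 0 < (starRingEnd ℂ m).re) :
    ‖expVec m hm‖ * ‖expVec (starRingEnd ℂ m) hm'‖ = 1 / (2 * m.re) := by
  have h1 := norm_expVec_sq m hm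
  have h2 := norm_expVec_sq _ hm'
  rw [Complex.conj_re, ← h1] at h2
  rw [(sq_eq_sq₀ (norm_nonneg _) (norm_nonneg _)).1 h2, ← sq, h1]

theorem norm_expOp_add_le {m : ℂ} (hm : 0 < m.re) :
    ‖expOp (fun x y => x + y) m‖ ≤ 1 / (2 * m.re) := by
  rw [expOp_add_eq_rankOne hm, InnerProductSpace.norm_rankOne, norm_expVec_mul_norm_expVec_conj]

/-- Splits off the decay `exp (-t x)` on both sides, to be spent later on the factors of the
perturbation. -/
theorem expOp_add_eq_mul_mul {m : ℂ} {t : ℝ} (ht : 0 ≤ t) (hm : t < m.re) :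
    expOp (fun x y => x + y) m = mulOp (fun x => Real.exp (-t * x)) *
      expOp (fun x y => x + y) (m - t) * mulOp (fun x => Real.exp (-t * x)) := by
  have hm' : 0 < (m - t).re := by simpa using hm
  have hs : ∀ {m : ℂ}, 0 < m.re → IsSchurKernel fun x y => Complex.exp (-m * (x + y : ℝ)) :=
    fun hm => isSchurKernel_exp (by fun_prop)
      (fun x y hx hy => abs_le.2 ⟨by linarith, by linarith⟩) hm
  ext1 f
  refine Lp.ext ?_
  rw [mul_apply_eq_comp, mul_apply_eq_comp]
  have hE := memLp_exp_neg ht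
  filter_upwards [intOp_apply_ae (hs (ht.trans_lt hm)) f,
    mulOp_apply_ae hE (expOp (fun x y => x + y) (m - t) (mulOp (fun x => Real.exp (-t * x)) f)),
    intOp_apply_ae (hs hm') (mulOp (fun x => Real.exp (-t * x)) f)] with x h1 h2 h3
  rw [h2, expOp, h1, expOp, h3, ← integral_const_mul]
  refine integral_congr_ae ?_
  filter_upwards [mulOp_apply_ae hE f] with y h4
  rw [h4, ← mul_assoc, ← mul_assoc]
  push_cast
  rw [← Complex.exp_add, ← Complex.exp_add]
  ring_nf

/-! ### Trace norm bounds and Cauchy estimates -/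

/-- The trace norm of `T` is at most `B`, as a bound on all finite diagonal sums. -/
def TraceLe (T : HalfL2 →L[ℂ] HalfL2) (B : ℝ) : Prop :=
  ∀ (n : ℕ) (e f : Fin n → HalfL2), Orthonormal ℂ e → Orthonormal ℂ f →
    ∑ i, ‖inner ℂ (f i) (T (e i))‖ ≤ B

/-- The diagonal matrix elements of an operator, as an element of `ℓ¹`. -/
def diagMap {n : ℕ} (e f : Fin n → HalfL2) :
    (HalfL2 →L[ℂ] HalfL2) →L[ℂ] PiLp 1 fun _ : Fin n => ℂ :=
  (PiLp.continuousLinearEquiv 1 ℂ fun _ : Fin n => ℂ).symm.toContinuousLinearMap ∘L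
    ContinuousLinearMap.pi fun i =>
      innerSL ℂ (f i) ∘L ContinuousLinearMap.apply ℂ HalfL2 (e i)

theorem norm_diagMap {n : ℕ} (e f : Fin n → HalfL2) (T : HalfL2 →L[ℂ] HalfL2) :
    ‖diagMap e f T‖ = ∑ i, ‖inner ℂ (f i) (T (e i))‖ := by
  rw [PiLp.norm_eq_of_L1]
  rfl

/-- Turns a trace norm bound into uniform norm bounds on continuous linear images, so that operator
norm convergence and Banach-valued Cauchy estimates yield trace norm statements. -/
theorem traceLe_iff {T : HalfL2 →L[ℂ] HalfL2} {B : ℝ} :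
    TraceLe T B ↔ ∀ (n : ℕ) (e f : Fin n → HalfL2), Orthonormal ℂ e → Orthonormal ℂ f →
      ‖diagMap e f T‖ ≤ B := by
  simp only [norm_diagMap, TraceLe]

theorem TraceLe.traceNorm_le {T : HalfL2 →L[ℂ] HalfL2} {B : ℝ} (h : TraceLe T B) :
    traceNorm T ≤ ENNReal.ofReal B := by
  refine iSup_le fun n => iSup_le fun e => iSup_le fun f => iSup_le fun he => iSup_le fun hf => ?_
  simp only [← ofReal_norm]
  rw [← ENNReal.ofReal_sum_of_nonneg fun _ _ => norm_nonneg _]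
  exact ENNReal.ofReal_le_ofReal (h n e f he hf)

theorem TraceLe.mono {T : HalfL2 →L[ℂ] HalfL2} {A B : ℝ} (h : TraceLe T A) (hAB : A ≤ B) :
    TraceLe T B := fun n e f he hf => (h n e f he hf).trans hAB

theorem TraceLe.sum {ι : Type*} {s : Finset ι} {T : ι → HalfL2 →L[ℂ] HalfL2} {B : ι → ℝ}
    (h : ∀ i ∈ s, TraceLe (T i) (B i)) : TraceLe (∑ i ∈ s, T i) (∑ i ∈ s, B i) := by
  rw [traceLe_iff]
  intro n e f he hf
  rw [map_sum]
  exact norm_sum_le_of_le _ fun i hi => traceLe_iff.1 (h i hi) n e f he hf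

theorem TraceLe.smul {T : HalfL2 →L[ℂ] HalfL2} {B : ℝ} (h : TraceLe T B) (c : ℂ) :
    TraceLe (c • T) (‖c‖ * B) := by
  rw [traceLe_iff] at h ⊢
  intro n e f he hf
  rw [map_smul, norm_smul]
  exact mul_le_mul_of_nonneg_left (h n e f he hf) (norm_nonneg _)

theorem TraceLe.hasSum {T : ℕ → HalfL2 →L[ℂ] HalfL2} {S : HalfL2 →L[ℂ] HalfL2} {B : ℕ → ℝ}
    {b : ℝ} (hT : HasSum T S) (hB : HasSum B b) (h : ∀ i, TraceLe (T i) (B i)) : TraceLe S b := by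
  rw [traceLe_iff]
  intro n e f he hf
  have := (diagMap e f).hasSum hT
  rw [← this.tsum_eq]
  exact tsum_of_norm_bounded hB fun i => traceLe_iff.1 (h i) n e f he hf

/-- Cauchy–Schwarz in the index, then Bessel's inequality for each orthonormal system. -/
theorem traceLe_rankOne (u v : HalfL2) : TraceLe (InnerProductSpace.rankOne ℂ u v) (‖u‖ * ‖v‖) := by
  intro n e f he hf
  have h1 := hf.sum_inner_products_le u (s := Finset.univ)
  have h2 := he.sum_inner_products_le v (s := Finset.univ)
  calc ∑ i, ‖inner ℂ (f i) (InnerProductSpace.rankOne ℂ u v (e i))‖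
      = ∑ i, ‖inner ℂ (f i) u‖ * ‖inner ℂ (e i) v‖ := by
        refine Finset.sum_congr rfl fun i _ => ?_
        rw [InnerProductSpace.rankOne_apply, inner_smul_right, norm_mul, mul_comm,
          norm_inner_symm v]
    _ ≤ √(∑ i, ‖inner ℂ (f i) u‖ ^ 2) * √(∑ i, ‖inner ℂ (e i) v‖ ^ 2) :=
        Real.sum_mul_le_sqrt_mul_sqrt _ _ _
    _ ≤ √(‖u‖ ^ 2) * √(‖v‖ ^ 2) := by gcongr
    _ = _ := by rw [Real.sqrt_sq (norm_nonneg _), Real.sqrt_sq (norm_nonneg _)]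

theorem traceLe_mul_rankOne_mul (A B : HalfL2 →L[ℂ] HalfL2) (u v : HalfL2) :
    TraceLe (A * InnerProductSpace.rankOne ℂ u v * B) (‖A‖ * (‖u‖ * ‖v‖) * ‖B‖) := by
  have : A * InnerProductSpace.rankOne ℂ u v * B =
      InnerProductSpace.rankOne ℂ (A u) (ContinuousLinearMap.adjoint B v) := by
    rw [← InnerProductSpace.rankOne_comp, ← InnerProductSpace.comp_rankOne]
    rfl
  rw [this]
  refine (traceLe_rankOne _ _).mono ?_
  have h1 := A.le_opNorm u
  have h2 := (ContinuousLinearMap.adjoint B).le_opNorm v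
  rw [LinearIsometryEquiv.norm_map] at h2
  calc _ ≤ (‖A‖ * ‖u‖) * (‖B‖ * ‖v‖) := by gcongr
    _ = _ := by ring

/-! ### Cauchy estimates for mixed derivatives. -/

section Cauchy

variable {E : Type*} [NormedAddCommGroup E] [NormedSpace ℂ E]

theorem iteratedDeriv_comp_clm_of_contDiffOn {F : Type*} [NormedAddCommGroup F] [NormedSpace ℂ F]
    (L : E →L[ℂ] F) {f : ℂ → E} {s : Set ℂ} (hs : IsOpen s) (hf : ContDiffOn ℂ ∞ f s) (n : ℕ)
    {x : ℂ} (hx : x ∈ s) : iteratedDeriv n (fun y => L (f y)) x = L (iteratedDeriv n f x) := by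
  have h := L.iteratedFDeriv_comp_left (hf.contDiffAt (hs.mem_nhds hx)) (i := n)
    (by exact_mod_cast le_top)
  rw [iteratedDeriv_eq_iteratedFDeriv, iteratedDeriv_eq_iteratedFDeriv]
  exact congrArg (fun m => m fun _ => (1 : ℂ)) h

/-- A derivative in the second variable is the Fréchet derivative applied to `(0, 1)`, so joint
smoothness survives; this is what permits differentiating in the first variable afterwards. -/
theorem contDiffOn_iteratedDeriv_snd {G : ℂ × ℂ → E} {U : Set (ℂ × ℂ)} (hU : IsOpen U)
    (hG : ContDiffOn ℂ ∞ G U) (n : ℕ) :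
    ContDiffOn ℂ ∞ (fun p : ℂ × ℂ => iteratedDeriv n (fun w => G (p.1, w)) p.2) U := by
  induction n with
  | zero => simpa using hG
  | succ n ih =>
    have h := (ih.fderiv_of_isOpen (m := ∞) hU (by simp)).clm_apply
      (contDiffOn_const (c := ((0 : ℂ), (1 : ℂ))))
    refine h.congr fun p hp => ?_
    have hd := ((ih.differentiableOn (by simp)).differentiableAt (hU.mem_nhds hp)).hasFDerivAt
    have hc : HasDerivAt (fun w : ℂ => (p.1, w)) ((0 : ℂ), (1 : ℂ)) p.2 :=
      (hasDerivAt_const _ _).prodMk (hasDerivAt_id _)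
    have := hd.comp_hasDerivAt p.2 hc
    rw [iteratedDeriv_succ]
    exact this.deriv

theorem contDiffOn_iteratedDeriv {f : ℂ → E} {s : Set ℂ} (hs : IsOpen s) (hf : ContDiffOn ℂ ∞ f s)
    (n : ℕ) : ContDiffOn ℂ ∞ (iteratedDeriv n f) s := by
  induction n with
  | zero => simpa using hf
  | succ n ih =>
    rw [iteratedDeriv_succ]
    exact ih.deriv_of_isOpen hs (by simp)

theorem hasDerivAt_comp_ofReal {f : ℂ → E} {f' : E} {x : ℝ} (hf : HasDerivAt f f' x) :
    HasDerivAt (fun y : ℝ => f y) f' x := by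
  have := hf.scomp x (Complex.ofRealCLM.hasDerivAt (x := x))
  rwa [Complex.ofRealCLM_apply, Complex.ofReal_one, one_smul] at this

theorem iteratedDeriv_comp_ofReal {f : ℂ → E} {s : Set ℂ} (hs : IsOpen s)
    (hf : ContDiffOn ℂ ∞ f s) {g : ℝ → E} (n : ℕ) (hg : ∀ x : ℝ, (x : ℂ) ∈ s → g x = f x)
    {x : ℝ} (hx : (x : ℂ) ∈ s) : iteratedDeriv n g x = iteratedDeriv n f x := by
  have ho : IsOpen {x : ℝ | (x : ℂ) ∈ s} := hs.preimage Complex.continuous_ofReal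
  induction n generalizing x with
  | zero => simpa using hg x hx
  | succ n ih =>
    rw [iteratedDeriv_succ, iteratedDeriv_succ]
    have h1 : iteratedDeriv n g =ᶠ[nhds x] fun y : ℝ => iteratedDeriv n f y := by
      filter_upwards [ho.mem_nhds hx] with y hy using ih hy
    rw [h1.deriv_eq]
    refine (hasDerivAt_comp_ofReal (DifferentiableAt.hasDerivAt ?_)).deriv
    exact ((contDiffOn_iteratedDeriv hs hf n).differentiableOn (by simp)).differentiableAt
      (hs.mem_nhds hx)

/-- The one-variable Cauchy estimate, applied in the second variable at each point of a circle in
the first, then in the first. -/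
theorem norm_iteratedDeriv_iteratedDeriv_le [CompleteSpace E] {G : ℂ × ℂ → E} {a b : ℂ} {r s B : ℝ}
    (hs : 0 < s) (hsr : s < r)
    (hG : ContDiffOn ℂ ∞ G (Metric.ball a r ×ˢ Metric.ball b r))
    (hB : ∀ p ∈ Metric.ball a r, ∀ q ∈ Metric.ball b r, ‖G (p, q)‖ ≤ B) (γ ν : ℕ) :
    ‖iteratedDeriv γ (fun p => iteratedDeriv ν (fun q => G (p, q)) b) a‖ ≤
      γ.factorial * (ν.factorial * B / s ^ ν) / s ^ γ := by
  have hU : IsOpen (Metric.ball a r ×ˢ Metric.ball b r) := Metric.isOpen_ball.prod Metric.isOpen_ball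
  have hsub : ∀ c : ℂ, Metric.closedBall c s ⊆ Metric.ball c r :=
    fun c => Metric.closedBall_subset_ball hsr
  have hb : b ∈ Metric.ball b r := Metric.mem_ball_self (hs.trans hsr)
  have dc : ∀ (c : ℂ) (f : ℂ → E), ContDiffOn ℂ ∞ f (Metric.ball c r) →
      DiffContOnCl ℂ f (Metric.ball c s) := fun c f hf =>
    ((hf.differentiableOn (by simp)).mono
      (Metric.closure_ball_subset_closedBall.trans (hsub c))).diffContOnCl
  refine Complex.norm_iteratedDeriv_le_of_forall_mem_sphere_norm_le γ hs (dc _ _ ?_) ?_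
  · exact (contDiffOn_iteratedDeriv_snd hU hG ν).comp (contDiffOn_id.prodMk contDiffOn_const)
      fun p hp => ⟨hp, hb⟩
  · intro p hp
    have hp' := hsub a (Metric.sphere_subset_closedBall hp)
    refine Complex.norm_iteratedDeriv_le_of_forall_mem_sphere_norm_le ν hs (dc _ _ ?_) ?_
    · exact hG.comp (contDiffOn_const.prodMk contDiffOn_id) fun q hq => ⟨hp', hq⟩
    · exact fun q hq => hB p hp' q (hsub b (Metric.sphere_subset_closedBall hq))

end Cauchy

/-- Cauchy's estimate, in trace norm, for the mixed derivatives of a real family of operators with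
a holomorphic extension to a bidisc. -/
theorem traceLe_mixedDeriv {F : ℝ → ℝ → HalfL2 →L[ℂ] HalfL2} {G : ℂ × ℂ → HalfL2 →L[ℂ] HalfL2}
    {l z r s B : ℝ} (hs : 0 < s) (hsr : s < r)
    (hG : ContDiffOn ℂ ∞ G (Metric.ball (l : ℂ) r ×ˢ Metric.ball (z : ℂ) r))
    (hFG : ∀ l' z' : ℝ, (l' : ℂ) ∈ Metric.ball (l : ℂ) r → (z' : ℂ) ∈ Metric.ball (z : ℂ) r →
      F l' z' = G (l', z'))
    (hB : ∀ p ∈ Metric.ball (l : ℂ) r, ∀ q ∈ Metric.ball (z : ℂ) r, TraceLe (G (p, q)) B)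
    (γ ν : ℕ) :
    TraceLe (mixedDeriv γ ν F l z) (γ.factorial * (ν.factorial * B / s ^ ν) / s ^ γ) := by
  have hU : IsOpen (Metric.ball (l : ℂ) r ×ˢ Metric.ball (z : ℂ) r) :=
    Metric.isOpen_ball.prod Metric.isOpen_ball
  have hl : (l : ℂ) ∈ Metric.ball (l : ℂ) r := Metric.mem_ball_self (hs.trans hsr)
  have hz : (z : ℂ) ∈ Metric.ball (z : ℂ) r := Metric.mem_ball_self (hs.trans hsr)
  have hslice : ∀ p ∈ Metric.ball (l : ℂ) r,
      ContDiffOn ℂ ∞ (fun q => G (p, q)) (Metric.ball (z : ℂ) r) := fun p hp =>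
    hG.comp (contDiffOn_const.prodMk contDiffOn_id) fun q hq => ⟨hp, hq⟩
  have hslice' : ContDiffOn ℂ ∞ (fun p => iteratedDeriv ν (fun q => G (p, q)) z)
      (Metric.ball (l : ℂ) r) :=
    (contDiffOn_iteratedDeriv_snd hU hG ν).comp (contDiffOn_id.prodMk contDiffOn_const)
      fun p hp => ⟨hp, hz⟩
  have h1 : mixedDeriv γ ν F l z = iteratedDeriv γ (fun p => iteratedDeriv ν (fun q => G (p, q)) z) l :=
    iteratedDeriv_comp_ofReal Metric.isOpen_ball hslice' γ
      (fun l' hl' => iteratedDeriv_comp_ofReal Metric.isOpen_ball (hslice l' hl') ν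
        (fun z' hz' => hFG l' z' hl' hz') hz) hl
  rw [traceLe_iff]
  intro n e f he hf
  rw [h1, ← iteratedDeriv_comp_clm_of_contDiffOn _ Metric.isOpen_ball hslice' γ hl]
  -- `diagMap e f` commutes with the inner derivative only on the ball, which suffices since the
  -- outer derivative is local.
  have h2 : iteratedDeriv γ (fun p => diagMap e f (iteratedDeriv ν (fun q => G (p, q)) z)) l =
      iteratedDeriv γ (fun p => iteratedDeriv ν (fun q => diagMap e f (G (p, q))) z) l := by
    refine Filter.EventuallyEq.iteratedDeriv_eq γ ?_
    filter_upwards [Metric.isOpen_ball.mem_nhds hl] with p hp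
    exact (iteratedDeriv_comp_clm_of_contDiffOn _ Metric.isOpen_ball (hslice p hp) ν hz).symm
  rw [h2]
  exact norm_iteratedDeriv_iteratedDeriv_le hs hsr
    ((diagMap e f).contDiff.comp_contDiffOn hG)
    (fun p hp q hq => traceLe_iff.1 (hB p hp q hq) n e f he hf) γ ν

/-! ### Noncommutative algebra: telescoping and weights -/

theorem mul_pow_mul_sub_eq_sum {R : Type*} [Ring R] (A B L : R) (N : ℕ) :
    (A * L) ^ N * A - (B * L) ^ N * B =
      ∑ j ∈ Finset.range (N + 1), (A * L) ^ j * (A - B) * (L * B) ^ (N - j) := by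
  induction N with
  | zero => simp
  | succ N ih =>
    have hB : ∀ n, (B * L) ^ (n + 1) * B = (B * L) ^ n * B * (L * B) := fun n => by
      rw [pow_succ]; noncomm_ring
    have e : (A * L) ^ (N + 1) * A - (B * L) ^ (N + 1) * B =
        ((A * L) ^ N * A - (B * L) ^ N * B) * (L * B) + (A * L) ^ (N + 1) * (A - B) := by
      rw [hB, pow_succ]; noncomm_ring
    rw [e, ih, Finset.sum_range_succ _ (N + 1), Finset.sum_mul, Nat.sub_self, pow_zero, mul_one]
    congr 1
    refine Finset.sum_congr rfl fun j hj => ?_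
    rw [Nat.succ_sub (Nat.lt_succ_iff.1 (Finset.mem_range.1 hj)), pow_succ, mul_assoc]

section Weights

variable {R : Type*} [NormedRing R] {E : ℕ → R} {K L D : R} {c d q : ℝ} {M : ℕ}

theorem norm_pow_le_of_norm_le {X : R} (h1 : ‖(1 : R)‖ ≤ 1) (hX : ‖X‖ ≤ q) (n : ℕ) :
    ‖X ^ n‖ ≤ q ^ n := by
  induction n with
  | zero => simpa using h1
  | succ n ih =>
    rw [pow_succ, pow_succ]
    exact (norm_mul_le _ _).trans
      (mul_le_mul ih hX (norm_nonneg _) (pow_nonneg ((norm_nonneg _).trans hX) _))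

/-- Each factor `K * L` consumes one weight: `L` turns `E (k + 1)` into `E k * D`, and `E k` then
moves left through `K`. -/
theorem norm_pow_mul_weight_le (hc : 0 ≤ c) (hd : 0 ≤ d) (h0 : ‖E 0‖ ≤ 1)
    (hK : ∀ k < M, ∃ K', K * E k = E k * K' ∧ ‖K'‖ ≤ c)
    (hL : ∀ k, L * E (k + 1) = E k * D) (hD : ‖D‖ ≤ d) {a : ℕ} (ha : a ≤ M) :
    ‖(K * L) ^ a * E a‖ ≤ (c * d) ^ a := by
  induction a with
  | zero => simpa using h0
  | succ a ih =>
    obtain ⟨K', h1, h2⟩ := hK a ha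
    have e : (K * L) ^ (a + 1) * E (a + 1) = ((K * L) ^ a * E a) * (K' * D) := by
      rw [pow_succ, mul_assoc, mul_assoc, hL, ← mul_assoc K, h1]
      noncomm_ring
    rw [e, pow_succ]
    exact (norm_mul_le _ _).trans (mul_le_mul (ih (Nat.le_of_succ_le ha))
      ((norm_mul_le _ _).trans (mul_le_mul h2 hD (norm_nonneg _) hc)) (norm_nonneg _)
      (by positivity))

theorem norm_weight_mul_pow_le (hc : 0 ≤ c) (hd : 0 ≤ d) (h0 : ‖E 0‖ ≤ 1)
    (hK : ∀ k < M, ∃ K', E k * K = K' * E k ∧ ‖K'‖ ≤ c)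
    (hL : ∀ k, E (k + 1) * L = D * E k) (hD : ‖D‖ ≤ d) {a : ℕ} (ha : a ≤ M) :
    ‖E a * (L * K) ^ a‖ ≤ (c * d) ^ a := by
  induction a with
  | zero => simpa using h0
  | succ a ih =>
    obtain ⟨K', h1, h2⟩ := hK a ha
    have e : E (a + 1) * (L * K) ^ (a + 1) = (D * K') * (E a * (L * K) ^ a) := by
      rw [pow_succ', ← mul_assoc, ← mul_assoc, hL, mul_assoc D, h1]
      noncomm_ring
    rw [e, pow_succ', mul_comm c d]
    refine (norm_mul_le _ _).trans (mul_le_mul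
      ((norm_mul_le _ _).trans (mul_le_mul hD h2 (norm_nonneg _) hd)) ?_ (norm_nonneg _)
      (by positivity))
    rw [mul_comm d c]
    exact ih (Nat.le_of_succ_le ha)

/-- The `a` innermost factors absorb `a` of the `M` weights; the outer `j - a` factors are bounded
by `q`, and the unused weights by `1`. -/
theorem norm_pow_mul_weight_le' (h1 : ‖(1 : R)‖ ≤ 1) (hc : 0 ≤ c) (hd : 0 ≤ d)
    (hE : ∀ k, ‖E k‖ ≤ 1) (hadd : ∀ j k, E (j + k) = E j * E k)
    (hK : ∀ k < M, ∃ K', K * E k = E k * K' ∧ ‖K'‖ ≤ c)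
    (hL : ∀ k, L * E (k + 1) = E k * D) (hD : ‖D‖ ≤ d) (hq : ‖K * L‖ ≤ q) {a j : ℕ}
    (ha : a ≤ M) (haj : a ≤ j) : ‖(K * L) ^ j * E M‖ ≤ q ^ (j - a) * (c * d) ^ a := by
  have hq0 : 0 ≤ q := (norm_nonneg _).trans hq
  have e : (K * L) ^ j * E M = (K * L) ^ (j - a) * ((K * L) ^ a * E a) * E (M - a) := by
    conv_lhs => rw [← Nat.sub_add_cancel haj, ← Nat.add_sub_cancel' ha, hadd, pow_add]
    simp only [mul_assoc]
  rw [e]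
  calc _ ≤ ‖(K * L) ^ (j - a)‖ * ‖(K * L) ^ a * E a‖ * ‖E (M - a)‖ := by
        refine (norm_mul_le _ _).trans ?_
        gcongr
        exact norm_mul_le _ _
    _ ≤ q ^ (j - a) * (c * d) ^ a * 1 := by
        gcongr
        · exact norm_pow_le_of_norm_le h1 hq _
        · exact norm_pow_mul_weight_le hc hd (hE 0) hK hL hD ha
        · exact hE _
    _ = _ := mul_one _

theorem norm_weight_mul_pow_le' (h1 : ‖(1 : R)‖ ≤ 1) (hc : 0 ≤ c) (hd : 0 ≤ d)
    (hE : ∀ k, ‖E k‖ ≤ 1) (hadd : ∀ j k, E (j + k) = E j * E k)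
    (hK : ∀ k < M, ∃ K', E k * K = K' * E k ∧ ‖K'‖ ≤ c)
    (hL : ∀ k, E (k + 1) * L = D * E k) (hD : ‖D‖ ≤ d) (hq : ‖L * K‖ ≤ q) {a j : ℕ}
    (ha : a ≤ M) (haj : a ≤ j) : ‖E M * (L * K) ^ j‖ ≤ q ^ (j - a) * (c * d) ^ a := by
  have hq0 : 0 ≤ q := (norm_nonneg _).trans hq
  have e : E M * (L * K) ^ j = E (M - a) * (E a * (L * K) ^ a) * (L * K) ^ (j - a) := by
    conv_lhs => rw [← Nat.add_sub_cancel' haj, ← Nat.sub_add_cancel ha, hadd, pow_add]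
    simp only [mul_assoc]
  rw [e]
  calc _ ≤ ‖E (M - a)‖ * ‖E a * (L * K) ^ a‖ * ‖(L * K) ^ (j - a)‖ := by
        refine (norm_mul_le _ _).trans ?_
        gcongr
        exact norm_mul_le _ _
    _ ≤ 1 * (c * d) ^ a * q ^ (j - a) := by
        gcongr
        · exact hE _
        · exact norm_weight_mul_pow_le hc hd (hE 0) hK hL hD ha
        · exact norm_pow_le_of_norm_le h1 hq _
    _ = _ := by ring

end Weights

/-- Trace norm of the difference of two Neumann terms whose resolvents differ by a rank one
operator sandwiched between weights. -/
theorem traceLe_neumann_sub {E : ℕ → HalfL2 →L[ℂ] HalfL2} {A B L D P Q : HalfL2 →L[ℂ] HalfL2}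
    {c d q : ℝ} {M N : ℕ} {κ : ℂ} {u v : HalfL2} (hMN : M ≤ N) (hc : 0 ≤ c) (hd : 0 ≤ d)
    (hE : ∀ k, ‖E k‖ ≤ 1) (hadd : ∀ j k, E (j + k) = E j * E k)
    (hA : ∀ k < M, ∃ K', A * E k = E k * K' ∧ ‖K'‖ ≤ c)
    (hB : ∀ k < M, ∃ K', E k * B = K' * E k ∧ ‖K'‖ ≤ c)
    (hL : ∀ k, L * E (k + 1) = E k * D) (hD : ‖D‖ ≤ d)
    (hL' : ∀ k, E (k + 1) * L = D * E k)
    (hqA : ‖A * L‖ ≤ q) (hqB : ‖L * B‖ ≤ q)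
    (hS : A - B = κ • (E M * InnerProductSpace.rankOne ℂ u v * E M)) :
    TraceLe (P * ((A * L) ^ N * A - (B * L) ^ N * B) * Q)
      ((N + 1) * (‖P‖ * ‖Q‖ * (‖κ‖ * (‖u‖ * ‖v‖) * ((c * d) ^ M * q ^ (N - M))))) := by
  have hq0 : 0 ≤ q := (norm_nonneg _).trans hqA
  have h1 : ‖(1 : HalfL2 →L[ℂ] HalfL2)‖ ≤ 1 := ContinuousLinearMap.norm_id_le
  rw [mul_pow_mul_sub_eq_sum, Finset.mul_sum, Finset.sum_mul]
  have hsum : ((N : ℝ) + 1) * (‖P‖ * ‖Q‖ * (‖κ‖ * (‖u‖ * ‖v‖) * ((c * d) ^ M * q ^ (N - M)))) =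
      ∑ j ∈ Finset.range (N + 1),
        ‖P‖ * ‖Q‖ * (‖κ‖ * (‖u‖ * ‖v‖) * ((c * d) ^ M * q ^ (N - M))) := by
    simp
  rw [hsum]
  refine TraceLe.sum fun j hj => ?_
  have hj : j ≤ N := Nat.lt_succ_iff.1 (Finset.mem_range.1 hj)
  have e : P * ((A * L) ^ j * (A - B) * (L * B) ^ (N - j)) * Q = κ • ((P * ((A * L) ^ j * E M)) *
      InnerProductSpace.rankOne ℂ u v * ((E M * (L * B) ^ (N - j)) * Q)) := by
    rw [hS]
    simp only [mul_smul_comm, smul_mul_assoc, mul_assoc]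
  rw [e]
  refine ((traceLe_mul_rankOne_mul _ _ u v).smul κ).mono ?_
  -- There are `N ≥ M` factors of `L` in all, so the `M` gains can be shared between the two sides
  -- of the rank one operator whatever `j` is.
  obtain ⟨a, b, hab, ha, hb⟩ : ∃ a b, a + b = M ∧ a ≤ j ∧ b ≤ N - j :=
    ⟨min j M, M - min j M, by omega, by omega, by omega⟩
  have hl := norm_pow_mul_weight_le' h1 hc hd hE hadd hA hL hD hqA (by omega : a ≤ M) ha
  have hr := norm_weight_mul_pow_le' h1 hc hd hE hadd hB hL' hD hqB (by omega : b ≤ M) hb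
  calc _ ≤ ‖κ‖ * ((‖P‖ * (q ^ (j - a) * (c * d) ^ a)) * (‖u‖ * ‖v‖) *
        ((q ^ (N - j - b) * (c * d) ^ b) * ‖Q‖)) := by
        gcongr
        · exact (norm_mul_le _ _).trans (by gcongr)
        · exact (norm_mul_le _ _).trans (by gcongr)
    _ = _ := by
      rw [show N - M = (j - a) + (N - j - b) by omega, ← hab, pow_add, pow_add]
      ring

/-! ### Multiplication operators and weights -/

theorem mulOp_comm {g h : ℝ → ℝ} (hg : MemLp (fun x => (g x : ℂ)) ⊤ halfLine)
    (hh : MemLp (fun x => (h x : ℂ)) ⊤ halfLine) : mulOp g * mulOp h = mulOp h * mulOp g := by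
  ext1 f
  refine Lp.ext ?_
  rw [mul_apply_eq_comp, mul_apply_eq_comp]
  filter_upwards [mulOp_apply_ae hg (mulOp h f), mulOp_apply_ae hh f, mulOp_apply_ae hg f,
    mulOp_apply_ae hh (mulOp g f)] with x h1 h2 h3 h4
  rw [h1, h2, h4, h3]
  ring

theorem norm_mulOp_mul_mulOp_le {g h : ℝ → ℝ} (hg : MemLp (fun x => (g x : ℂ)) ⊤ halfLine)
    (hh : MemLp (fun x => (h x : ℂ)) ⊤ halfLine) {c : ℝ} (hc : 0 ≤ c)
    (hgh : ∀ x, 0 < x → |g x * h x| ≤ c) : ‖mulOp g * mulOp h‖ ≤ c := by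
  refine ContinuousLinearMap.opNorm_le_bound _ hc fun f => ?_
  refine Lp.norm_le_mul_norm_of_ae_le_mul ?_
  rw [mul_apply_eq_comp]
  filter_upwards [mulOp_apply_ae hg (mulOp h f), mulOp_apply_ae hh f,
    ae_restrict_mem measurableSet_Ioi] with x h1 h2 hx0
  rw [h1, h2, ← mul_assoc, ← Complex.ofReal_mul, norm_mul, Complex.norm_real, Real.norm_eq_abs]
  gcongr
  exact hgh x hx0

/-- Multiplication by `exp (-t x)`. -/
def weight (t : ℝ) : HalfL2 →L[ℂ] HalfL2 := mulOp fun x => Real.exp (-t * x)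

theorem norm_weight_le {t : ℝ} (ht : 0 ≤ t) : ‖weight t‖ ≤ 1 := by
  refine norm_mulOp_le (memLp_exp_neg ht) zero_le_one fun x hx => ?_
  rw [Real.abs_exp, Real.exp_le_one_iff]
  nlinarith

theorem weight_add {s t : ℝ} (hs : 0 ≤ s) (ht : 0 ≤ t) : weight (s + t) = weight s * weight t :=
  (mulOp_mul_mulOp (memLp_exp_neg hs) (memLp_exp_neg ht) (memLp_exp_neg (add_nonneg hs ht))
    fun x _ => by rw [← Real.exp_add]; ring_nf).symm

/-! ### The resolvent operators with complex parameters -/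

/-- The operator with kernel `(exp (-m |x - y|) + c exp (-m (x + y))) / (2 m)`. -/
def robinOp (c m : ℂ) : HalfL2 →L[ℂ] HalfL2 :=
  (1 / (2 * m)) • (expOp (fun x y => |x - y|) m + c • expOp (fun x y => x + y) m)

theorem abs_sub_le_add_of_pos (x y : ℝ) (hx : 0 < x) (hy : 0 < y) : |x - y| ≤ x + y :=
  abs_le.2 ⟨by linarith, by linarith⟩

theorem isSchurKernel_exp_abs {m : ℂ} (hm : 0 < m.re) :
    IsSchurKernel fun x y => Complex.exp (-m * (|x - y| : ℝ)) :=
  isSchurKernel_exp (by fun_prop) (fun _ _ _ _ => le_rfl) hm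

theorem isSchurKernel_exp_add {m : ℂ} (hm : 0 < m.re) :
    IsSchurKernel fun x y => Complex.exp (-m * (x + y : ℝ)) :=
  isSchurKernel_exp (by fun_prop) abs_sub_le_add_of_pos hm

theorem robinOp_eq_intOp (c : ℂ) {m : ℂ} (hm : 0 < m.re) :
    robinOp c m = intOp fun x y => 1 / (2 * m) * Complex.exp (-m * (|x - y| : ℝ)) +
      1 / (2 * m) * c * Complex.exp (-m * (x + y : ℝ)) := by
  rw [intOp_linear_combination (1 / (2 * m)) (1 / (2 * m) * c) (isSchurKernel_exp_abs hm)
    (isSchurKernel_exp_add hm) ((isSchurKernel_exp_abs hm).linear_combination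
    (isSchurKernel_exp_add hm) _ _) fun _ _ _ _ => rfl, robinOp, smul_add, smul_smul]
  rfl

theorem measurable_robinKernel (c m : ℂ) : Measurable (Function.uncurry fun x y : ℝ =>
    1 / (2 * m) * Complex.exp (-m * (|x - y| : ℝ)) +
      1 / (2 * m) * c * Complex.exp (-m * (x + y : ℝ))) := by
  have h1 := measurable_expKernel (d := fun x y => |x - y|) (by fun_prop) m
  have h2 := measurable_expKernel (d := fun x y => x + y) (by fun_prop) m
  exact (h1.const_mul _).add (h2.const_mul _)

theorem norm_robinKernel_le (c : ℂ) {m : ℂ} (hm : 0 < m.re) (x y : ℝ) (hx : 0 < x) (hy : 0 < y) :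
    ‖1 / (2 * m) * Complex.exp (-m * (|x - y| : ℝ)) +
      1 / (2 * m) * c * Complex.exp (-m * (x + y : ℝ))‖ ≤
      (1 + ‖c‖) / (2 * ‖m‖) * Real.exp (-m.re * |x - y|) := by
  have h1 := norm_expKernel_le (d := fun x y => |x - y|) (fun _ _ _ _ => le_rfl) hm x y hx hy
  have h2 := norm_expKernel_le (d := fun x y => x + y) abs_sub_le_add_of_pos hm x y hx hy
  rw [one_mul] at h1 h2
  have e : ‖1 / (2 * m)‖ = 1 / (2 * ‖m‖) := by simp
  calc _ ≤ 1 / (2 * ‖m‖) * Real.exp (-m.re * |x - y|) +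
        1 / (2 * ‖m‖) * ‖c‖ * Real.exp (-m.re * |x - y|) := by
        refine (norm_add_le _ _).trans ?_
        rw [norm_mul, norm_mul, norm_mul, e]
        gcongr
    _ = _ := by ring

/-- The reflected part is measured by its exact rank one bound `1 / (2 * m.re)`, a quarter of the
Schur bound. The cruder estimate would give a ratio above `1` in
`norm_robinOp_mul_norm_perturbOp_le`. -/
theorem norm_robinOp_le (c : ℂ) {m : ℂ} (hm : 0 < m.re) :
    ‖robinOp c m‖ ≤ (2 + ‖c‖ / 2) / (2 * ‖m‖ * m.re) := by
  have h1 := norm_expOp_le (d := fun x y => |x - y|) (by fun_prop) (fun _ _ _ _ => le_rfl) hm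
  have h2 := norm_expOp_add_le hm
  have e : ‖1 / (2 * m)‖ = 1 / (2 * ‖m‖) := by simp
  rw [robinOp, norm_smul, e]
  calc _ ≤ 1 / (2 * ‖m‖) * (2 / m.re + ‖c‖ * (1 / (2 * m.re))) := by
        gcongr
        refine (norm_add_le _ _).trans ?_
        rw [norm_smul]
        gcongr
    _ = _ := by
      have : ‖m‖ ≠ 0 := fun h => by
        rw [norm_eq_zero] at h
        simp [h] at hm
      field_simp

theorem robinOp_sub_robinOp_zero (c m : ℂ) :
    robinOp c m - robinOp 0 m = (1 / (2 * m) * c) • expOp (fun x y => x + y) m := by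
  rw [robinOp, robinOp, zero_smul, add_zero, smul_add, add_sub_cancel_left, smul_smul]

theorem exists_robinOp_mul_weight (c : ℂ) {m : ℂ} {t : ℝ} (ht : 0 ≤ t) (hm : t < m.re) :
    ∃ K', robinOp c m * weight t = weight t * K' ∧
      ‖K'‖ ≤ 2 * ((1 + ‖c‖) / (2 * ‖m‖)) / (m.re - t) := by
  have hm0 := ht.trans_lt hm
  rw [robinOp_eq_intOp c hm0]
  exact exists_intOp_mul_exp (measurable_robinKernel c m) (by positivity) ht hm
    (norm_robinKernel_le c hm0)

theorem exists_weight_mul_robinOp (c : ℂ) {m : ℂ} {t : ℝ} (ht : 0 ≤ t) (hm : t < m.re) :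
    ∃ K', weight t * robinOp c m = K' * weight t ∧
      ‖K'‖ ≤ 2 * ((1 + ‖c‖) / (2 * ‖m‖)) / (m.re - t) := by
  have hm0 := ht.trans_lt hm
  rw [robinOp_eq_intOp c hm0]
  exact exists_exp_mul_intOp (measurable_robinKernel c m) (by positivity) ht hm
    (norm_robinKernel_le c hm0)

theorem contDiffAt_robinOp {m : ℂ} (hm : 0 < m.re) {c : ℂ → ℂ} {n : WithTop ℕ∞}
    (hc : ContDiffAt ℂ n c m) : ContDiffAt ℂ n (fun m => robinOp (c m) m) m := by
  have hm0 : (2 : ℂ) * m ≠ 0 := by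
    intro h
    simp at h
    simp [h] at hm
  have h1 : ContDiffAt ℂ n (expOp fun x y => |x - y|) m :=
    contDiffAt_expOp (by fun_prop) (fun _ _ _ _ => le_rfl) hm
  have h2 : ContDiffAt ℂ n (expOp fun x y => x + y) m :=
    contDiffAt_expOp (by fun_prop) abs_sub_le_add_of_pos hm
  exact (contDiffAt_const.div (contDiffAt_const.mul contDiffAt_id) hm0).smul (h1.add (hc.smul h2))

theorem intOp_robinKernel (θ : ℝ) {μ : ℝ} (hμ : 0 < μ) :
    intOp (fun x y => (robinKernel θ μ x y : ℂ)) = robinOp (reflCoeff μ θ) μ := by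
  rw [robinOp_eq_intOp _ (by simpa using hμ)]
  congr 1
  funext x y
  rw [robinKernel]
  push_cast
  ring

theorem intOp_lineKernel {μ : ℝ} (hμ : 0 < μ) :
    intOp (fun x y => (lineKernel μ x y : ℂ)) = robinOp 0 μ := by
  rw [robinOp_eq_intOp _ (by simpa using hμ)]
  congr 1
  funext x y
  rw [lineKernel]
  push_cast
  ring

/-! ### Bounds at a complex parameter -/

/-- The perturbation `p² a + b` as a multiplication operator with complex coupling. -/
def perturbOp (a b : ℝ → ℝ) (p : ℂ) : HalfL2 →L[ℂ] HalfL2 := p ^ 2 • mulOp a + mulOp b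

/-- Bounds on the two coefficients of the perturbation. -/
structure CoeffBounds (a b : ℝ → ℝ) (v w L : ℝ) : Prop where
  v_pos : 0 < v
  w_nonneg : 0 ≤ w
  L_nonneg : 0 ≤ L
  memLp_a : MemLp (fun x => (a x : ℂ)) ⊤ halfLine
  memLp_b : MemLp (fun x => (b x : ℂ)) ⊤ halfLine
  a_le_mul : ∀ x, 0 < x → |a x| ≤ L * x
  a_le : ∀ x, 0 < x → |a x| ≤ v / 2
  b_le : ∀ x, 0 < x → |b x| ≤ w

/-- Bounds on complexified parameters in terms of a real reference size `μ`. -/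
structure ParamBounds (v w μ : ℝ) (p m c : ℂ) : Prop where
  one_le : 1 ≤ μ
  w_le : w ≤ μ ^ 2 / 100
  p_le : ‖p‖ ^ 2 * v ≤ 101 / 100 * μ ^ 2
  m_re : 99 / 100 * μ ≤ m.re
  c_le : ‖c‖ ≤ 3 / 2

section Bounds

variable {a b : ℝ → ℝ} {v w L μ : ℝ} {p m c : ℂ}

theorem ParamBounds.zero (h : ParamBounds v w μ p m c) : ParamBounds v w μ p m 0 :=
  { h with c_le := by norm_num }

theorem ParamBounds.re_pos (h : ParamBounds v w μ p m c) : 0 < m.re := by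
  linarith [h.one_le, h.m_re]

theorem ParamBounds.le_norm (h : ParamBounds v w μ p m c) : 99 / 100 * μ ≤ ‖m‖ :=
  h.m_re.trans (Complex.re_le_norm m)

/-- The bound `|a| ≤ v / 2` gives `101 / 200` and the `w` term gives `1 / 100`. -/
theorem norm_perturbOp_le (ha : CoeffBounds a b v w L) (h : ParamBounds v w μ p m c) :
    ‖perturbOp a b p‖ ≤ 103 / 200 * μ ^ 2 := by
  have hv := ha.v_pos
  have h1 := norm_mulOp_le ha.memLp_a (c := v / 2) (by positivity) ha.a_le
  have h2 := norm_mulOp_le ha.memLp_b ha.w_nonneg ha.b_le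
  calc ‖perturbOp a b p‖ ≤ ‖p‖ ^ 2 * (v / 2) + w := by
        refine (norm_add_le _ _).trans ?_
        rw [norm_smul, norm_pow]
        gcongr
    _ ≤ _ := by linarith [h.p_le, h.w_le]

theorem norm_robinOp_le_of_bounds (h : ParamBounds v w μ p m c) :
    ‖robinOp c m‖ ≤ 29 / 20 / μ ^ 2 := by
  have hμ : 0 < μ := by linarith [h.one_le]
  have hm := h.re_pos
  refine (norm_robinOp_le c hm).trans ?_
  calc (2 + ‖c‖ / 2) / (2 * ‖m‖ * m.re)
      ≤ (2 + 3 / 2 / 2) / (2 * (99 / 100 * μ) * (99 / 100 * μ)) := by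
        have := h.m_re
        have := h.le_norm
        have := h.c_le
        gcongr
    _ ≤ _ := by
        rw [div_le_div_iff₀ (by positivity) (by positivity)]
        nlinarith [sq_nonneg μ]

theorem norm_robinOp_mul_norm_perturbOp_le (ha : CoeffBounds a b v w L)
    (h : ParamBounds v w μ p m c) : ‖robinOp c m‖ * ‖perturbOp a b p‖ ≤ 3 / 4 := by
  have hμ : 0 < μ := by linarith [h.one_le]
  calc _ ≤ (29 / 20 / μ ^ 2) * (103 / 200 * μ ^ 2) :=
        mul_le_mul (norm_robinOp_le_of_bounds h) (norm_perturbOp_le ha h) (norm_nonneg _)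
          (by positivity)
    _ = 29 / 20 * (103 / 200) := by field_simp
    _ ≤ _ := by norm_num

theorem norm_robinOp_mul_perturbOp_le (ha : CoeffBounds a b v w L)
    (h : ParamBounds v w μ p m c) : ‖robinOp c m * perturbOp a b p‖ ≤ 3 / 4 :=
  (norm_mul_le _ _).trans (norm_robinOp_mul_norm_perturbOp_le ha h)

theorem norm_perturbOp_mul_robinOp_le (ha : CoeffBounds a b v w L)
    (h : ParamBounds v w μ p m c) : ‖perturbOp a b p * robinOp c m‖ ≤ 3 / 4 :=
  (norm_mul_le _ _).trans (mul_comm ‖perturbOp a b p‖ _ ▸ norm_robinOp_mul_norm_perturbOp_le ha h)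

theorem perturbOp_mul_weight_comm (ha : CoeffBounds a b v w L) (p : ℂ) {t : ℝ} (ht : 0 ≤ t) :
    perturbOp a b p * weight t = weight t * perturbOp a b p := by
  rw [perturbOp, add_mul, mul_add, smul_mul_assoc, mul_smul_comm, weight,
    mulOp_comm ha.memLp_a (memLp_exp_neg ht), mulOp_comm ha.memLp_b (memLp_exp_neg ht)]

/-- Here first order vanishing at the origin pays off: `x * exp (-t * x) ≤ 1 / t`. Only the part
with coupling `p ^ 2` needs it. -/
theorem norm_perturbOp_mul_weight_le (ha : CoeffBounds a b v w L) (p : ℂ) {t : ℝ} (ht : 0 < t) :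
    ‖perturbOp a b p * weight t‖ ≤ ‖p‖ ^ 2 * (L / t) + w := by
  have hL := ha.L_nonneg
  have h1 : ‖mulOp a * weight t‖ ≤ L / t := by
    refine norm_mulOp_mul_mulOp_le ha.memLp_a (memLp_exp_neg ht.le) (by positivity) fun x hx => ?_
    have h2 := pow_mul_exp_neg_le ht hx.le 1
    rw [abs_mul, Real.abs_exp]
    calc |a x| * Real.exp (-t * x) ≤ L * x * Real.exp (-t * x) := by
          gcongr
          exact ha.a_le_mul x hx
      _ = L * (x ^ 1 * Real.exp (-t * x)) := by ring
      _ ≤ L * ((1 : ℕ).factorial / t ^ 1) := by gcongr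
      _ = _ := by simp [div_eq_mul_inv]
  have h2 := norm_mulOp_le ha.memLp_b ha.w_nonneg ha.b_le
  rw [perturbOp, add_mul, smul_mul_assoc]
  refine (norm_add_le _ _).trans ?_
  rw [norm_smul, norm_pow]
  gcongr
  exact (norm_mul_le _ _).trans ((mul_le_mul h2 (norm_weight_le ht.le) (norm_nonneg _)
    ha.w_nonneg).trans_eq (mul_one w))

theorem conj_bound_le (h : ParamBounds v w μ p m c) {t : ℝ} (ht : t ≤ μ / 2) :
    2 * ((1 + ‖c‖) / (2 * ‖m‖)) / (m.re - t) ≤ 6 / μ ^ 2 := by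
  have hμ : 0 < μ := by linarith [h.one_le]
  calc _ ≤ 2 * ((1 + 3 / 2) / (2 * (99 / 100 * μ))) / (99 / 100 * μ - μ / 2) := by
        have := h.m_re
        have := h.le_norm
        have := h.c_le
        gcongr
        linarith
    _ = (1250 / (99 * 49 / 100)) / (5 * μ ^ 2) := by
        field_simp
        norm_num
    _ ≤ _ := by
        rw [div_le_div_iff₀ (by positivity) (by positivity)]
        nlinarith [sq_nonneg μ]

theorem traceLe_neumann (ha : CoeffBounds a b v w L) (h : ParamBounds v w μ p m c)
    {M N : ℕ} (hM : 1 ≤ M) (hMN : M ≤ N) (P Q : HalfL2 →L[ℂ] HalfL2) :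
    TraceLe (P * ((robinOp c m * perturbOp a b p) ^ N * robinOp c m -
        (robinOp 0 m * perturbOp a b p) ^ N * robinOp 0 m) * Q)
      ((N + 1) * (‖P‖ * ‖Q‖ * (1 / μ ^ 2 *
        ((6 / μ ^ 2 * ((3 * M * L / v + w) * μ)) ^ M * (3 / 4) ^ (N - M))))) := by
  have h1μ := h.one_le
  have hμ : 0 < μ := by linarith
  have hM0 : (0 : ℝ) < M := by exact_mod_cast hM
  have hv := ha.v_pos
  have hw := ha.w_nonneg
  have hL := ha.L_nonneg
  -- `M` weights make up `exp (-μ x / 2)`, which leaves a decay rate of at least `49 / 100 * μ` for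
  -- the conjugated kernels and the rank one vectors.
  set δ := μ / (2 * M) with hδ
  have hδ0 : 0 < δ := by positivity
  have hE0 : ∀ k : ℕ, 0 ≤ k * δ := fun k => by positivity
  have hMδ : M * δ = μ / 2 := by rw [hδ]; field_simp
  have hkδ : ∀ k < M, k * δ ≤ μ / 2 := fun k hk => by
    rw [← hMδ]
    gcongr
  have hre : μ / 2 < m.re := by linarith [h.m_re]
  set E : ℕ → HalfL2 →L[ℂ] HalfL2 := fun k => weight (k * δ) with hEdef
  have hadd : ∀ j k, E (j + k) = E j * E k := fun j k => by
    simp only [hEdef]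
    rw [← weight_add (hE0 j) (hE0 k)]
    push_cast
    ring_nf
  have hcomm : ∀ k, perturbOp a b p * E k = E k * perturbOp a b p := fun k =>
    perturbOp_mul_weight_comm ha p (hE0 k)
  have hD : ‖perturbOp a b p * E 1‖ ≤ (3 * M * L / v + w) * μ := by
    have h1 := norm_perturbOp_mul_weight_le ha p (t := ((1 : ℕ) : ℝ) * δ) (by simpa using hδ0)
    refine h1.trans ?_
    have h2 : ‖p‖ ^ 2 ≤ 101 / 100 * μ ^ 2 / v := (le_div_iff₀ hv).2 h.p_le
    -- Since `1 / δ = 2 * M / μ`, one power of `μ` cancels; the `w` term is weakened to `w * μ`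
    -- using `1 ≤ μ`.
    calc _ ≤ 101 / 100 * μ ^ 2 / v * (L / (((1 : ℕ) : ℝ) * δ)) + w * μ := by
          gcongr
          exact le_mul_of_one_le_right hw h1μ
      _ = 101 / 50 * (M * L / v * μ) + w * μ := by
          rw [hδ]
          field_simp
          push_cast
          ring
      _ ≤ 3 * (M * L / v * μ) + w * μ := by
          gcongr
          norm_num
      _ = _ := by ring
  have hm' : 0 < (m - (μ / 2 : ℝ)).re := by simpa using hre
  have hS : robinOp c m - robinOp 0 m = (1 / (2 * m) * c) • (E M * InnerProductSpace.rankOne ℂ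
      (expVec _ hm') (expVec (starRingEnd ℂ (m - (μ / 2 : ℝ))) (by rwa [Complex.conj_re])) *
        E M) := by
    rw [robinOp_sub_robinOp_zero, expOp_add_eq_mul_mul (by positivity) hre,
      expOp_add_eq_rankOne hm']
    simp only [hEdef, hMδ]
    rfl
  have key := traceLe_neumann_sub (E := E) (P := P) (Q := Q) hMN (c := 6 / μ ^ 2) (by positivity)
    (d := (3 * M * L / v + w) * μ) (by positivity)
    (fun k => norm_weight_le (hE0 k)) hadd
    (fun k hk => by
      obtain ⟨K', h1, h2⟩ := exists_robinOp_mul_weight c (hE0 k) ((hkδ k hk).trans_lt hre)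
      exact ⟨K', h1, h2.trans (conj_bound_le h (hkδ k hk))⟩)
    (fun k hk => by
      obtain ⟨K', h1, h2⟩ := exists_weight_mul_robinOp 0 (hE0 k) ((hkδ k hk).trans_lt hre)
      exact ⟨K', h1, h2.trans (conj_bound_le h.zero (hkδ k hk))⟩)
    (L := perturbOp a b p)
    (fun k => by rw [hadd, ← mul_assoc, hcomm, mul_assoc]) hD
    (fun k => by rw [add_comm k 1, hadd, mul_assoc, ← hcomm, ← mul_assoc, ← hcomm])
    (norm_robinOp_mul_perturbOp_le ha h) (norm_perturbOp_mul_robinOp_le ha h.zero) hS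
  refine key.mono ?_
  have hs : ‖1 / (2 * m) * c‖ * (‖expVec _ hm'‖ *
      ‖expVec (starRingEnd ℂ (m - (μ / 2 : ℝ))) (by rwa [Complex.conj_re])‖) ≤ 1 / μ ^ 2 := by
    rw [norm_expVec_mul_norm_expVec_conj, norm_mul]
    have e : ‖1 / (2 * m)‖ = 1 / (2 * ‖m‖) := by simp
    have e2 : (m - (μ / 2 : ℝ)).re = m.re - μ / 2 := by simp
    rw [e, e2]
    calc _ ≤ 1 / (2 * (99 / 100 * μ)) * (3 / 2) * (1 / (2 * (99 / 100 * μ - μ / 2))) := by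
          have := h.m_re
          have := h.le_norm
          have := h.c_le
          gcongr
          linarith
      _ = (3750 / (99 * 49)) / μ ^ 2 := by
          field_simp
          norm_num
      _ ≤ _ := by
          gcongr
          norm_num
  gcongr

end Bounds

/-! ### Complexified parameters -/

/-- The complexified spectral parameter. -/
def specParamC (v : ℝ) (p : ℂ × ℂ) : ℂ := (p.1 ^ 2 * v + p.2 ^ 2) ^ (2⁻¹ : ℂ)

/-- The complexified reflection coefficient. -/
def reflCoeffC (θ : ℝ) (m : ℂ) : ℂ :=
  (m * Real.sin θ + Real.cos θ) / (m * Real.sin θ - Real.cos θ)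

theorem norm_sq_sub_sq_le {l μ ε : ℝ} {p : ℂ} (hp : ‖p - l‖ ≤ ε * μ) :
    ‖p ^ 2 - (l : ℂ) ^ 2‖ ≤ 2 * |l| * (ε * μ) + (ε * μ) ^ 2 := by
  have e : p ^ 2 - (l : ℂ) ^ 2 = 2 * l * (p - l) + (p - l) ^ 2 := by ring
  rw [e]
  refine (norm_add_le _ _).trans ?_
  rw [norm_mul, norm_mul, norm_pow, Complex.norm_real, Real.norm_eq_abs, Complex.norm_ofNat]
  gcongr

/-- The radius, relative to `μ`, of the bidiscs on which the resolvents are controlled. -/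
def bidiscScale (v : ℝ) : ℝ := 1 / (1000 * (1 + v))

theorem bidiscScale_pos {v : ℝ} (hv : 0 < v) : 0 < bidiscScale v := by
  unfold bidiscScale
  positivity

/-- Since `ε * (1 + v) = 1 / 1000`, moving `p` and `q` by `ε * μ` changes the squared spectral
parameter by a small fraction of `μ ^ 2`, uniformly in the real centre. -/
theorem norm_spec_sub_le {v l z μ : ℝ} (hv : 0 < v) (hμ : 0 < μ) (h : μ ^ 2 = l ^ 2 * v + z ^ 2)
    {p q : ℂ} (hp : ‖p - l‖ ≤ bidiscScale v * μ) (hq : ‖q - z‖ ≤ bidiscScale v * μ) :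
    ‖p‖ ^ 2 * v ≤ 101 / 100 * μ ^ 2 ∧ ‖p ^ 2 * v + q ^ 2 - (μ ^ 2 : ℝ)‖ ≤ μ ^ 2 / 100 := by
  have h1 := norm_sq_sub_sq_le hp
  have h2 := norm_sq_sub_sq_le hq
  set ε := bidiscScale v with hε
  have hε0 : 0 < ε := bidiscScale_pos hv
  have hεv : ε * (1 + v) = 1 / 1000 := by
    rw [hε, bidiscScale]
    field_simp
  have hεle : ε ≤ 1 / 1000 := by nlinarith
  have hεv' : ε * v ≤ 1 / 1000 := by nlinarith
  have hz : |z| ≤ μ := 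
    abs_le_of_sq_le_sq (by nlinarith [mul_nonneg (sq_nonneg l) hv.le]) hμ.le
  -- From `(v * |l| - μ) ^ 2 ≥ 0` together with `v * l ^ 2 ≤ μ ^ 2`.
  have hl : 2 * v * |l| * μ ≤ (1 + v) * μ ^ 2 := by
    have h3 : l ^ 2 * v ≤ μ ^ 2 := by nlinarith [sq_nonneg z]
    have h4 : v ^ 2 * |l| ^ 2 ≤ v * μ ^ 2 := by
      rw [sq_abs]
      nlinarith
    nlinarith [sq_nonneg (v * |l| - μ)]
  have a1 : (2 * |l| * (ε * μ) + (ε * μ) ^ 2) * v ≤ 2 / 1000 * μ ^ 2 := by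
    have e1 : 2 * v * |l| * μ * ε ≤ (1 + v) * μ ^ 2 * ε := by gcongr
    have e2 : (1 + v) * μ ^ 2 * ε = 1 / 1000 * μ ^ 2 := by rw [← hεv]; ring
    have e3 : (ε * v) * ε * μ ^ 2 ≤ 1 / 1000 * 1 * μ ^ 2 := by
      gcongr
      linarith
    nlinarith
  have a2 : 2 * |z| * (ε * μ) + (ε * μ) ^ 2 ≤ 3 / 1000 * μ ^ 2 := by
    have e1 : 2 * |z| * (ε * μ) ≤ 2 * μ * (1 / 1000 * μ) := by gcongr
    have e2 : (ε * μ) ^ 2 ≤ (1 / 1000 * μ) ^ 2 := by gcongr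
    nlinarith [sq_nonneg μ]
  constructor
  · have e : ‖p‖ ^ 2 ≤ l ^ 2 + (2 * |l| * (ε * μ) + (ε * μ) ^ 2) := by
      rw [← norm_pow]
      have := norm_le_norm_add_norm_sub ((l : ℂ) ^ 2) (p ^ 2)
      rw [norm_sub_rev, norm_pow (l : ℂ), Complex.norm_real, Real.norm_eq_abs, sq_abs] at this
      linarith
    have : ‖p‖ ^ 2 * v ≤ (l ^ 2 + (2 * |l| * (ε * μ) + (ε * μ) ^ 2)) * v := by gcongr
    nlinarith [sq_nonneg z, sq_nonneg μ]
  · have e : p ^ 2 * v + q ^ 2 - (μ ^ 2 : ℝ) =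
        (p ^ 2 - (l : ℂ) ^ 2) * v + (q ^ 2 - (z : ℂ) ^ 2) := by
      rw [h]
      push_cast
      ring
    rw [e]
    refine (norm_add_le _ _).trans ?_
    rw [norm_mul, Complex.norm_real, Real.norm_eq_abs, abs_of_pos hv]
    have : ‖p ^ 2 - (l : ℂ) ^ 2‖ * v ≤ (2 * |l| * (ε * μ) + (ε * μ) ^ 2) * v := by gcongr
    nlinarith [sq_nonneg μ]

theorem le_re_of_norm_sub_le {μ : ℝ} {ζ : ℂ} (h : ‖ζ - (μ ^ 2 : ℝ)‖ ≤ μ ^ 2 / 100) :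
    99 / 100 * μ ^ 2 ≤ ζ.re := by
  have h1 := (Complex.abs_re_le_norm _).trans h
  rw [Complex.sub_re, Complex.ofReal_re, abs_le] at h1
  linarith [h1.1]

/-- The real part of the principal root is `√((‖ζ‖ + ζ.re) / 2)`, hence at least `√ζ.re`. -/
theorem le_re_cpow_of_norm_sub_le {μ : ℝ} {ζ : ℂ}
    (h : ‖ζ - (μ ^ 2 : ℝ)‖ ≤ μ ^ 2 / 100) : 99 / 100 * μ ≤ (ζ ^ (2⁻¹ : ℂ)).re := by
  have h1 := le_re_of_norm_sub_le h
  rw [Complex.cpow_inv_two_re]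
  refine Real.le_sqrt_of_sq_le ?_
  nlinarith [Complex.re_le_norm ζ, sq_nonneg μ]

/-- In the Dirichlet case `sin θ = 0` the coefficient is `-1`. Otherwise, with `s = ‖m‖ * sin θ ≥
5`, it is at most `(s + 1) / (s - 1) ≤ 3 / 2`. -/
theorem reflCoeffC_bounds {θ : ℝ} (hθ : θ ∈ Set.Ico 0 Real.pi) {m : ℂ}
    (hm : Real.sin θ ≠ 0 → 5 ≤ ‖m‖ * Real.sin θ) :
    ‖reflCoeffC θ m‖ ≤ 3 / 2 ∧ m * Real.sin θ - Real.cos θ ≠ 0 := by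
  have hs : 0 ≤ Real.sin θ := Real.sin_nonneg_of_nonneg_of_le_pi hθ.1 hθ.2.le
  by_cases h0 : Real.sin θ = 0
  · have hc : Real.cos θ ≠ 0 := by
      intro hc
      have := Real.sin_sq_add_cos_sq θ
      simp [h0, hc] at this
    have hc' : (Real.cos θ : ℂ) ≠ 0 := by exact_mod_cast hc
    rw [reflCoeffC, h0]
    simp only [Complex.ofReal_zero, mul_zero, zero_add, zero_sub]
    refine ⟨?_, neg_ne_zero.2 hc'⟩
    rw [div_neg, div_self hc', norm_neg, norm_one]
    norm_num
  · have h5 := hm h0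
    have hn : ‖m * Real.sin θ‖ = ‖m‖ * Real.sin θ := by
      rw [norm_mul, Complex.norm_real, Real.norm_eq_abs, abs_of_nonneg hs]
    have hc : ‖(Real.cos θ : ℂ)‖ ≤ 1 := by
      rw [Complex.norm_real]
      exact Real.abs_cos_le_one θ
    have hden : ‖m‖ * Real.sin θ - 1 ≤ ‖m * Real.sin θ - Real.cos θ‖ := by
      have := norm_sub_norm_le (m * Real.sin θ) (Real.cos θ : ℂ)
      linarith
    have hnum : ‖m * Real.sin θ + Real.cos θ‖ ≤ ‖m‖ * Real.sin θ + 1 := by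
      have := norm_add_le (m * Real.sin θ) (Real.cos θ : ℂ)
      linarith
    have hpos : 0 < ‖m * Real.sin θ - Real.cos θ‖ := by linarith
    refine ⟨?_, norm_pos_iff.1 hpos⟩
    rw [reflCoeffC, norm_div, div_le_iff₀ hpos]
    linarith

theorem paramBounds_of_mem_bidisc {θ : ℝ} (hθ : θ ∈ Set.Ico 0 Real.pi) {v w l z μ : ℝ}
    (hv : 0 < v) (h1 : 1 ≤ μ) (hw : 100 * w ≤ μ) (hθμ : 6 / Real.sin θ ≤ μ)
    (h : μ ^ 2 = l ^ 2 * v + z ^ 2) {p q : ℂ} (hp : ‖p - l‖ ≤ bidiscScale v * μ)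
    (hq : ‖q - z‖ ≤ bidiscScale v * μ) :
    ParamBounds v w μ p (specParamC v (p, q)) (reflCoeffC θ (specParamC v (p, q))) ∧
      specParamC v (p, q) * Real.sin θ - Real.cos θ ≠ 0 ∧ 0 < (p ^ 2 * v + q ^ 2).re := by
  have hμ : 0 < μ := by linarith
  obtain ⟨a1, a2⟩ := norm_spec_sub_le hv hμ h hp hq
  have hre : 99 / 100 * μ ≤ (specParamC v (p, q)).re := le_re_cpow_of_norm_sub_le a2
  have hr := reflCoeffC_bounds hθ (m := specParamC v (p, q)) fun hs => by
    have hs' : 0 < Real.sin θ :=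
      (Real.sin_nonneg_of_nonneg_of_le_pi hθ.1 hθ.2.le).lt_of_ne' hs
    have h6 : 6 ≤ μ * Real.sin θ := (div_le_iff₀ hs').1 hθμ
    have h7 := hre.trans (Complex.re_le_norm _)
    have h8 : 99 / 100 * μ * Real.sin θ ≤ ‖specParamC v (p, q)‖ * Real.sin θ := by gcongr
    linarith
  refine ⟨⟨h1, ?_, a1, hre, hr.1⟩, hr.2, ?_⟩
  · nlinarith
  · have := le_re_of_norm_sub_le a2
    have : 0 < μ ^ 2 := by positivity
    linarith

/-! ### The holomorphic extension of the Neumann terms -/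

section Extension

variable (θ v : ℝ) (a b φ ψ : ℝ → ℝ)

/-- The holomorphic extension of `neumannTerm`. -/
def neumannTermC (N : ℕ) (p : ℂ × ℂ) : HalfL2 →L[ℂ] HalfL2 :=
  let m := specParamC v p
  let A := robinOp (reflCoeffC θ m) m
  let B := robinOp 0 m
  let L := perturbOp a b p.1
  (-1 : ℂ) ^ N • (mulOp ψ * ((A * L) ^ N * A - (B * L) ^ N * B) * mulOp φ)

/-- The sum of the tail of a Neumann series. -/
def neumannTail (M : ℕ) (K L : HalfL2 →L[ℂ] HalfL2) : HalfL2 →L[ℂ] HalfL2 :=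
  (-(K * L)) ^ M * Ring.inverse (1 - -(K * L)) * K

variable {θ v a b φ ψ}

theorem hasSum_neumannTail (M : ℕ) {K L : HalfL2 →L[ℂ] HalfL2} (h : ‖K * L‖ < 1) :
    HasSum (fun j : ℕ => (-1 : ℂ) ^ (M + j) • ((K * L) ^ (M + j) * K)) (neumannTail M K L) := by
  have h1 := hasSum_geom_series_inverse (-(K * L)) (by rwa [norm_neg])
  refine ((h1.mul_left ((-(K * L)) ^ M)).mul_right K).congr_fun ?_
  intro j
  rw [← pow_add, ← neg_one_smul ℂ (K * L), smul_pow, smul_mul_assoc]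

theorem hasSum_neumannTermC (M : ℕ) {p : ℂ × ℂ}
    (h1 : ‖robinOp (reflCoeffC θ (specParamC v p)) (specParamC v p) * perturbOp a b p.1‖ < 1)
    (h2 : ‖robinOp 0 (specParamC v p) * perturbOp a b p.1‖ < 1) :
    HasSum (fun j : ℕ => neumannTermC θ v a b φ ψ (M + j) p)
      (mulOp ψ * (neumannTail M (robinOp (reflCoeffC θ (specParamC v p)) (specParamC v p))
        (perturbOp a b p.1) - neumannTail M (robinOp 0 (specParamC v p)) (perturbOp a b p.1)) *
        mulOp φ) := by
  have := (((hasSum_neumannTail M h1).sub (hasSum_neumannTail M h2)).mul_left (mulOp ψ)).mul_right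
    (mulOp φ)
  refine this.congr_fun fun j => ?_
  rw [neumannTermC, ← smul_sub, mul_smul_comm, smul_mul_assoc]

theorem contDiffAt_specParamC {p : ℂ × ℂ} (h : 0 < (p.1 ^ 2 * v + p.2 ^ 2).re) {n : WithTop ℕ∞} :
    ContDiffAt ℂ n (specParamC v) p := by
  have h1 : DifferentiableOn ℂ (fun ζ : ℂ => ζ ^ (2⁻¹ : ℂ)) Complex.slitPlane := fun ζ hζ =>
    (DifferentiableAt.cpow_const differentiableAt_id hζ).differentiableWithinAt
  have h2 : ContDiffAt ℂ n (fun ζ : ℂ => ζ ^ (2⁻¹ : ℂ)) (p.1 ^ 2 * v + p.2 ^ 2) :=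
    (h1.contDiffOn Complex.isOpen_slitPlane).contDiffAt
      (Complex.isOpen_slitPlane.mem_nhds (Or.inl h))
  have h3 : ContDiffAt ℂ n (fun p : ℂ × ℂ => p.1 ^ 2 * v + p.2 ^ 2) p := by fun_prop
  exact h2.comp p h3

theorem contDiffAt_perturbOp {p : ℂ × ℂ} {n : WithTop ℕ∞} :
    ContDiffAt ℂ n (fun p : ℂ × ℂ => perturbOp a b p.1) p :=
  ((contDiffAt_fst.pow 2).smul contDiffAt_const).add contDiffAt_const

theorem contDiffAt_robinOp_specParamC {p : ℂ × ℂ} (h : 0 < (p.1 ^ 2 * v + p.2 ^ 2).re)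
    (hm : 0 < (specParamC v p).re) {c : ℂ → ℂ} {n : WithTop ℕ∞}
    (hc : ContDiffAt ℂ n c (specParamC v p)) :
    ContDiffAt ℂ n (fun p => robinOp (c (specParamC v p)) (specParamC v p)) p :=
  (contDiffAt_robinOp hm hc).comp p (contDiffAt_specParamC h)

theorem contDiffAt_reflCoeffC {m : ℂ} (h : m * Real.sin θ - Real.cos θ ≠ 0) {n : WithTop ℕ∞} :
    ContDiffAt ℂ n (reflCoeffC θ) m :=
  ((contDiffAt_id.mul contDiffAt_const).add contDiffAt_const).div
    ((contDiffAt_id.mul contDiffAt_const).sub contDiffAt_const) h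

theorem contDiffAt_neumannTermC (N : ℕ) {p : ℂ × ℂ} (h : 0 < (p.1 ^ 2 * v + p.2 ^ 2).re)
    (hm : 0 < (specParamC v p).re) (hr : specParamC v p * Real.sin θ - Real.cos θ ≠ 0)
    {n : WithTop ℕ∞} : ContDiffAt ℂ n (neumannTermC θ v a b φ ψ N) p := by
  have hA := contDiffAt_robinOp_specParamC h hm (contDiffAt_reflCoeffC hr (n := n))
  have hB := contDiffAt_robinOp_specParamC h hm (contDiffAt_const (c := (0 : ℂ)) (n := n))
  have hL := contDiffAt_perturbOp (a := a) (b := b) (p := p) (n := n)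
  exact ((contDiffAt_const.mul ((((hA.mul hL).pow N).mul hA).sub
    (((hB.mul hL).pow N).mul hB))).mul contDiffAt_const).const_smul _

/-- Inversion is smooth at units, and `1 + K L` is one because `‖K L‖ < 1`; no termwise
differentiation of the series is needed. -/
theorem ContDiffAt.neumannTail {M : ℕ} {K L : ℂ × ℂ → HalfL2 →L[ℂ] HalfL2} {p : ℂ × ℂ}
    {n : WithTop ℕ∞} (hK : ContDiffAt ℂ n K p) (hL : ContDiffAt ℂ n L p) (h : ‖K p * L p‖ < 1) :
    ContDiffAt ℂ n (fun p => neumannTail M (K p) (L p)) p := by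
  have hX := (hK.mul hL).neg
  have hi : ContDiffAt ℂ n (fun p => Ring.inverse (1 - -(K p * L p))) p :=
    ContDiffAt.comp (g := Ring.inverse) (f := fun p => 1 - -(K p * L p)) p
      (contDiffAt_ringInverse ℂ (Units.oneSub (-(K p * L p)) (by rwa [norm_neg])))
      (contDiffAt_const.sub hX)
  exact ((hX.pow M).mul hi).mul hK

end Extension

/-! ### Identification with the real family -/

theorem specParamC_ofReal {V : ℝ → ℝ} (hV : 0 < V 0) (l z : ℝ) :
    specParamC (V 0) (l, z) = specParam V l z := by
  rw [specParamC, specParam, Real.sqrt_eq_rpow, Complex.ofReal_cpow (by positivity)]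
  push_cast
  norm_num

theorem reflCoeffC_ofReal (θ μ : ℝ) : reflCoeffC θ μ = reflCoeff μ θ := by
  rw [reflCoeffC, reflCoeff]
  push_cast
  rfl

theorem mulOp_perturb {V W ψ : ℝ → ℝ} (hψ : IsCutoff ψ) (hV : ContinuousOn V (Set.Icc 0 1))
    (hW : ContinuousOn W (Set.Icc 0 1)) (l : ℝ) : mulOp (perturb V W ψ l) =
      perturbOp (fun x => ψ x * (V x - V 0)) (fun x => ψ x * W x) l := by
  rw [mulOp_linear_combination (s := l ^ 2) (hψ.memLp_mul (hV.sub continuousOn_const))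
    (hψ.memLp_mul hW) (memLp_perturb hψ hV hW l) fun x => rfl, perturbOp, Complex.ofReal_pow]
  rfl

theorem neumannTerm_eq {θ : ℝ} {V W φ ψ : ℝ → ℝ} (hψ : IsCutoff ψ)
    (hV : ContinuousOn V (Set.Icc 0 1)) (hW : ContinuousOn W (Set.Icc 0 1)) (hV0 : 0 < V 0) (N : ℕ)
    {l z : ℝ} (h : 0 < specParam V l z) : neumannTerm θ V W φ ψ N l z =
      neumannTermC θ (V 0) (fun x => ψ x * (V x - V 0)) (fun x => ψ x * W x) φ ψ N (l, z) := by
  simp only [neumannTerm, neumannTermC]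
  rw [intOp_robinKernel θ h, intOp_lineKernel h, mulOp_perturb hψ hV hW, specParamC_ofReal hV0,
    reflCoeffC_ofReal]

/-- The linear bound comes from the mean value inequality: `L` is the product of bounds for `ψ` and
for the derivative of `V` on `[0, 1]`, and beyond `1` the cutoff vanishes. -/
theorem exists_coeffBounds {V W ψ : ℝ → ℝ} (hV : ContDiffOn ℝ ∞ V (Set.Icc 0 1))
    (hW : ContDiffOn ℝ ∞ W (Set.Icc 0 1)) (hV0 : 0 < V 0) (hψ : IsCutoff ψ)
    (hψV : ∀ x, 0 ≤ x → |ψ x * (V x - V 0)| ≤ V 0 / 2) :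
    ∃ w L, CoeffBounds (fun x => ψ x * (V x - V 0)) (fun x => ψ x * W x) (V 0) w L := by
  have hψc : ContinuousOn ψ (Set.Icc 0 1) := hψ.smooth.continuousOn.mono fun x hx => hx.1
  obtain ⟨w, hw⟩ := isCompact_Icc.exists_bound_of_continuousOn (hψc.mul hW.continuousOn)
  obtain ⟨k, hk⟩ := isCompact_Icc.exists_bound_of_continuousOn hψc
  obtain ⟨s, hs⟩ := isCompact_Icc.exists_bound_of_continuousOn
    (hV.continuousOn_derivWithin (uniqueDiffOn_Icc zero_lt_one) (by simp))
  have h0 : (0 : ℝ) ∈ Set.Icc (0 : ℝ) 1 := by simp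
  have hw0 : 0 ≤ w := (norm_nonneg _).trans (hw 0 h0)
  have hk0 : 0 ≤ k := (norm_nonneg _).trans (hk 0 h0)
  have hs0 : 0 ≤ s := (norm_nonneg _).trans (hs 0 h0)
  refine ⟨w, k * s, hV0, hw0, by positivity, hψ.memLp_mul (hV.continuousOn.sub continuousOn_const),
    hψ.memLp_mul hW.continuousOn, fun x hx => ?_, fun x hx => hψV x hx.le, fun x hx => ?_⟩
  · rcases le_or_gt x 1 with h1 | h1
    · have hx' : x ∈ Set.Icc (0 : ℝ) 1 := ⟨hx.le, h1⟩
      have := (convex_Icc (0 : ℝ) 1).norm_image_sub_le_of_norm_derivWithin_le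
        (hV.differentiableOn (by simp)) hs h0 hx'
      rw [sub_zero, Real.norm_eq_abs, Real.norm_eq_abs, abs_of_pos hx] at this
      rw [abs_mul, mul_assoc]
      exact mul_le_mul (hk x hx') this (abs_nonneg _) hk0
    · rw [hψ.eq_zero h1.le, zero_mul, abs_zero]
      positivity
  · rcases le_or_gt x 1 with h1 | h1
    · exact hw x ⟨hx.le, h1⟩
    · rw [hψ.eq_zero h1.le, zero_mul, abs_zero]
      exact hw0

theorem contDiffAt_of_extension {E : Type*} [NormedAddCommGroup E] [NormedSpace ℂ E]
    {F : ℝ → ℝ → E} {G : ℂ × ℂ → E} {l z r : ℝ} (hr : 0 < r)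
    (hG : ContDiffOn ℂ ∞ G (Metric.ball (l : ℂ) r ×ˢ Metric.ball (z : ℂ) r))
    (hFG : ∀ l' z' : ℝ, (l' : ℂ) ∈ Metric.ball (l : ℂ) r → (z' : ℂ) ∈ Metric.ball (z : ℂ) r →
      F l' z' = G (l', z')) : ContDiffAt ℝ ∞ (fun p : ℝ × ℝ => F p.1 p.2) (l, z) := by
  have hU : IsOpen (Metric.ball (l : ℂ) r ×ˢ Metric.ball (z : ℂ) r) :=
    Metric.isOpen_ball.prod Metric.isOpen_ball
  have hmem : ((l : ℂ), (z : ℂ)) ∈ Metric.ball (l : ℂ) r ×ˢ Metric.ball (z : ℂ) r :=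
    ⟨Metric.mem_ball_self hr, Metric.mem_ball_self hr⟩
  let ι : ℝ × ℝ →L[ℝ] ℂ × ℂ := Complex.ofRealCLM.prodMap Complex.ofRealCLM
  have h1 : ContDiffAt ℝ ∞ G (ι (l, z)) := (hG.contDiffAt (hU.mem_nhds hmem)).restrict_scalars ℝ
  refine (h1.comp (l, z) ι.contDiff.contDiffAt).congr_of_eventuallyEq ?_
  filter_upwards [(hU.preimage ι.continuous).mem_nhds hmem] with p hp
  exact hFG p.1 p.2 hp.1 hp.2

theorem traceLe_mixedDeriv_of_scale {F : ℝ → ℝ → HalfL2 →L[ℂ] HalfL2}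
    {G : ℂ × ℂ → HalfL2 →L[ℂ] HalfL2} {l z ε μ β : ℝ} (hε : 0 < ε) (hμ : 1 ≤ μ) (hβ : 0 ≤ β) (M : ℕ)
    (hG : ContDiffOn ℂ ∞ G (Metric.ball (l : ℂ) (ε * μ) ×ˢ Metric.ball (z : ℂ) (ε * μ)))
    (hFG : ∀ l' z' : ℝ, (l' : ℂ) ∈ Metric.ball (l : ℂ) (ε * μ) →
      (z' : ℂ) ∈ Metric.ball (z : ℂ) (ε * μ) → F l' z' = G (l', z'))
    (hB : ∀ p ∈ Metric.ball (l : ℂ) (ε * μ), ∀ q ∈ Metric.ball (z : ℂ) (ε * μ),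
      TraceLe (G (p, q)) (β * (1 / μ) ^ (M + 2))) (γ ν : ℕ) :
    TraceLe (mixedDeriv γ ν F l z) (γ.factorial * ν.factorial * (2 / ε) ^ (γ + ν) * β *
      μ ^ (-(M : ℝ) - γ - ν - 3 / 2)) := by
  have hμ0 : 0 < μ := by linarith
  refine (traceLe_mixedDeriv (s := ε * μ / 2) (by positivity) (half_lt_self (by positivity))
    hG hFG hB γ ν).mono ?_
  have e : (γ.factorial * (ν.factorial * (β * (1 / μ) ^ (M + 2)) / (ε * μ / 2) ^ ν) /
      (ε * μ / 2) ^ γ : ℝ) =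
      γ.factorial * ν.factorial * (2 / ε) ^ (γ + ν) * β * (μ ^ (M + 2 + γ + ν))⁻¹ := by
    simp only [div_pow, mul_pow, pow_add, one_pow]
    field_simp
  rw [e]
  gcongr
  rw [← Real.rpow_natCast, ← Real.rpow_neg hμ0.le]
  -- The estimate has `2` where `3 / 2` is asked for; `1 ≤ μ` allows the half power to be dropped.
  refine Real.rpow_le_rpow_of_exponent_le hμ ?_
  push_cast
  linarith

end

/-! ### Proof of the proposition. -/

theorem mainTheorem5
    (θ : ℝ) (hθ : θ ∈ Set.Ico 0 Real.pi)
    (V W φ ψ : ℝ → ℝ)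
    (hV : ContDiffOn ℝ ∞ V (Set.Icc 0 1)) (hW : ContDiffOn ℝ ∞ W (Set.Icc 0 1))
    (hV0 : 0 < V 0)
    (hφ : IsCutoff φ) (hψ : IsCutoff ψ)
    (hφψ : halfSupport φ ⊆ halfSupport ψ)
    (hφdψ : Disjoint (halfSupport φ) (halfSupport (derivWithin ψ (Set.Ici 0))))
    (hψV : ∀ x, 0 ≤ x → |ψ x * (V x - V 0)| ≤ V 0 / 2)
    (M γ ν : ℕ) (hM : 1 ≤ M) :
    ∃ μs : ℝ, 0 < μs ∧ ∀ μ₀ : ℝ, μs ≤ μ₀ →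
      (∃ C q : ℝ, 0 < C ∧ 0 < q ∧ q < 1 ∧
        ∀ N : ℕ, M ≤ N → ∀ l z : ℝ, μ₀ ≤ specParam V l z →
          ContDiffAt ℝ ∞ (fun p : ℝ × ℝ => neumannTerm θ V W φ ψ N p.1 p.2) (l, z) ∧
          traceNorm (mixedDeriv γ ν (neumannTerm θ V W φ ψ N) l z) ≤
            ENNReal.ofReal (C * N * q ^ (N - M) *
              specParam V l z ^ (-(M : ℝ) - γ - ν - 3 / 2))) ∧
      (∃ C : ℝ, 0 < C ∧
        ∀ l z : ℝ, μ₀ ≤ specParam V l z →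
          Summable (fun j : ℕ => neumannTerm θ V W φ ψ (M + j) l z) ∧
          ContDiffAt ℝ ∞
            (fun p : ℝ × ℝ => ∑' j : ℕ, neumannTerm θ V W φ ψ (M + j) p.1 p.2) (l, z) ∧
          traceNorm
              (mixedDeriv γ ν (fun l' z' => ∑' j : ℕ, neumannTerm θ V W φ ψ (M + j) l' z') l z) ≤
            ENNReal.ofReal (C * specParam V l z ^ (-(M : ℝ) - γ - ν - 3 / 2))) := by
  obtain ⟨w, L, hc⟩ := exists_coeffBounds hV hW hV0 hψ hψV
  set a : ℝ → ℝ := fun x => ψ x * (V x - V 0) with ha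
  set b : ℝ → ℝ := fun x => ψ x * W x with hb
  set v := V 0 with hv
  set ε := bidiscScale v with hεdef
  have hε : 0 < ε := bidiscScale_pos hV0
  have hw := hc.w_nonneg
  have hL := hc.L_nonneg
  set G := neumannTermC θ v a b φ ψ with hGdef
  set D := ‖mulOp ψ‖ * ‖mulOp φ‖ * (6 * (3 * M * L / v + w)) ^ M with hD
  have hD0 : 0 ≤ D := by positivity
  set A := γ.factorial * ν.factorial * (2 / ε) ^ (γ + ν) with hA
  have hA0 : 0 ≤ A := by positivity
  -- `100 * w` makes the `W` part negligible against `μ ^ 2`, and `6 / sin θ` keeps the pole of the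
  -- reflection coefficient away. For `sin θ = 0` that quotient is `0` and imposes nothing.
  set μs := max 1 (max (100 * w) (6 / Real.sin θ)) with hμs
  have hμs1 : 1 ≤ μs := le_max_left _ _
  refine ⟨μs, by linarith, fun μ₀ hμ₀ => ?_⟩
  have bounds : ∀ l z : ℝ, μ₀ ≤ specParam V l z → 1 ≤ specParam V l z ∧
      ∀ p ∈ Metric.ball (l : ℂ) (ε * specParam V l z),
      ∀ q ∈ Metric.ball (z : ℂ) (ε * specParam V l z),
      ParamBounds v w (specParam V l z) p (specParamC v (p, q))
        (reflCoeffC θ (specParamC v (p, q))) ∧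
      specParamC v (p, q) * Real.sin θ - Real.cos θ ≠ 0 ∧ 0 < (p ^ 2 * v + q ^ 2).re := by
    intro l z hlz
    have h1 := hμ₀.trans hlz
    refine ⟨hμs1.trans h1, fun p hp q hq => ?_⟩
    exact paramBounds_of_mem_bidisc hθ hV0 (hμs1.trans h1)
      (((le_max_left _ _).trans (le_max_right _ _)).trans h1)
      (((le_max_right _ _).trans (le_max_right _ _)).trans h1)
      (Real.sq_sqrt (by positivity)) (mem_ball_iff_norm.1 hp).le (mem_ball_iff_norm.1 hq).le
  have ext : ∀ l z : ℝ, μ₀ ≤ specParam V l z → ∀ l' z' : ℝ,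
      (l' : ℂ) ∈ Metric.ball (l : ℂ) (ε * specParam V l z) →
      (z' : ℂ) ∈ Metric.ball (z : ℂ) (ε * specParam V l z) →
      ∀ N, neumannTerm θ V W φ ψ N l' z' = G N (l', z') := by
    intro l z hlz l' z' hl' hz' N
    -- Real points of the bidisc may have spectral parameter below `μ₀`; only its positivity is
    -- needed, and it follows from `0 < Re m`.
    refine neumannTerm_eq hψ hV.continuousOn hW.continuousOn hV0 N ?_
    have h1 := ((bounds l z hlz).2 _ hl' _ hz').1.re_pos
    rwa [specParamC_ofReal hV0, Complex.ofReal_re] at h1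
  have trace : ∀ l z : ℝ, μ₀ ≤ specParam V l z →
      ∀ p ∈ Metric.ball (l : ℂ) (ε * specParam V l z),
      ∀ q ∈ Metric.ball (z : ℂ) (ε * specParam V l z), ∀ N, M ≤ N →
      TraceLe (G N (p, q)) (D * (N + 1) * (3 / 4) ^ (N - M) * (1 / specParam V l z) ^ (M + 2)) := by
    intro l z hlz p hp q hq N hN
    obtain ⟨h1, h2⟩ := bounds l z hlz
    have := (traceLe_neumann hc (h2 p hp q hq).1 hM hN (mulOp ψ) (mulOp φ)).smul ((-1) ^ N)
    refine this.mono (le_of_eq ?_)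
    have hμ : specParam V l z ≠ 0 := by linarith
    rw [norm_pow, norm_neg, norm_one, one_pow, one_mul, hD]
    have e : 6 / specParam V l z ^ 2 * ((3 * M * L / v + w) * specParam V l z) =
        6 * (3 * M * L / v + w) * (1 / specParam V l z) := by
      field_simp
    rw [e, mul_pow _ (1 / specParam V l z), pow_add]
    ring
  have smooth : ∀ l z : ℝ, μ₀ ≤ specParam V l z → ∀ N, ContDiffOn ℂ ∞ (G N)
      (Metric.ball (l : ℂ) (ε * specParam V l z) ×ˢ Metric.ball (z : ℂ) (ε * specParam V l z)) := by
    intro l z hlz N p hp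
    obtain ⟨h1, h2, h3⟩ := (bounds l z hlz).2 p.1 hp.1 p.2 hp.2
    exact (contDiffAt_neumannTermC N h3 h1.re_pos h2).contDiffWithinAt
  constructor
  -- The factor `2` comes from `N + 1 ≤ 2 * N`, valid as `1 ≤ M ≤ N`; the `+ 1` only makes the
  -- constant positive.
  · refine ⟨2 * (A * D) + 1, 3 / 4, by positivity, by norm_num, by norm_num,
      fun N hN l z hlz => ?_⟩
    have h1 := (bounds l z hlz).1
    have hμ0 : 0 < specParam V l z := by linarith
    refine ⟨contDiffAt_of_extension (mul_pos hε hμ0) (smooth l z hlz N)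
      fun l' z' hl' hz' => ext l z hlz l' z' hl' hz' N, ?_⟩
    refine ((traceLe_mixedDeriv_of_scale hε h1 (by positivity) M (smooth l z hlz N)
      (fun l' z' hl' hz' => ext l z hlz l' z' hl' hz' N)
      (fun p hp q hq => trace l z hlz p hp q hq N hN) γ ν).mono ?_).traceNorm_le
    gcongr ?_ * _
    have hN1 : (1 : ℝ) ≤ N := by exact_mod_cast hM.trans hN
    calc _ = A * D * (N + 1) * (3 / 4) ^ (N - M) := by ring
      _ ≤ A * D * (2 * N) * (3 / 4) ^ (N - M) := by
        gcongr
        linarith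
      _ = 2 * (A * D) * N * (3 / 4) ^ (N - M) := by ring
      _ ≤ (2 * (A * D) + 1) * N * (3 / 4) ^ (N - M) := by
        gcongr
        linarith
  · have hsum : Summable fun j : ℕ => ((M + j : ℕ) + 1 : ℝ) * (3 / 4 : ℝ) ^ j := by
      have h1 := summable_pow_mul_geometric_of_norm_lt_one 1 (r := (3 / 4 : ℝ)) (by norm_num)
      have h2 := (summable_geometric_of_norm_lt_one (x := (3 / 4 : ℝ)) (by norm_num)).mul_left
        ((M : ℝ) + 1)
      refine (h1.add h2).congr fun j => ?_
      push_cast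
      ring
    set S := ∑' j : ℕ, ((M + j : ℕ) + 1 : ℝ) * (3 / 4 : ℝ) ^ j with hS
    have hS0 : 0 ≤ S := tsum_nonneg fun j => by positivity
    refine ⟨A * (D * S) + 1, by positivity, fun l z hlz => ?_⟩
    have h1 := (bounds l z hlz).1
    have hμ0 : 0 < specParam V l z := by linarith
    -- Closed form of the summed tail, holomorphic on the whole bidisc and equal there to the sum of
    -- the extended terms.
    set T : ℂ × ℂ → HalfL2 →L[ℂ] HalfL2 := fun p =>
      mulOp ψ * (neumannTail M (robinOp (reflCoeffC θ (specParamC v p)) (specParamC v p))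
        (perturbOp a b p.1) - neumannTail M (robinOp 0 (specParamC v p)) (perturbOp a b p.1)) *
        mulOp φ with hT
    have hTsum : ∀ p ∈ Metric.ball (l : ℂ) (ε * specParam V l z),
        ∀ q ∈ Metric.ball (z : ℂ) (ε * specParam V l z),
        HasSum (fun j : ℕ => G (M + j) (p, q)) (T (p, q)) := fun p hp q hq => by
      have h2 := ((bounds l z hlz).2 p hp q hq).1
      exact hasSum_neumannTermC M
        ((norm_robinOp_mul_perturbOp_le hc h2).trans_lt (by norm_num))
        ((norm_robinOp_mul_perturbOp_le hc h2.zero).trans_lt (by norm_num))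
    have hTsmooth : ContDiffOn ℂ ∞ T (Metric.ball (l : ℂ) (ε * specParam V l z) ×ˢ
        Metric.ball (z : ℂ) (ε * specParam V l z)) := by
      intro p hp
      obtain ⟨h2, h3, h4⟩ := (bounds l z hlz).2 p.1 hp.1 p.2 hp.2
      have hK1 := contDiffAt_robinOp_specParamC h4 h2.re_pos
        (contDiffAt_reflCoeffC h3 (n := ∞))
      have hK2 := contDiffAt_robinOp_specParamC h4 h2.re_pos
        (contDiffAt_const (c := (0 : ℂ)) (n := ∞))
      have hΛ := contDiffAt_perturbOp (a := a) (b := b) (p := p) (n := ∞)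
      have t1 := hK1.neumannTail (M := M) hΛ
        ((norm_robinOp_mul_perturbOp_le hc h2).trans_lt (by norm_num))
      have t2 := hK2.neumannTail (M := M) hΛ
        ((norm_robinOp_mul_perturbOp_le hc h2.zero).trans_lt (by norm_num))
      exact ((contDiffAt_const.mul (t1.sub t2)).mul contDiffAt_const).contDiffWithinAt
    have hsumF : ∀ l' z' : ℝ, (l' : ℂ) ∈ Metric.ball (l : ℂ) (ε * specParam V l z) →
        (z' : ℂ) ∈ Metric.ball (z : ℂ) (ε * specParam V l z) →
        HasSum (fun j : ℕ => neumannTerm θ V W φ ψ (M + j) l' z') (T (l', z')) :=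
      fun l' z' hl' hz' => by
        simp only [ext l z hlz l' z' hl' hz']
        exact hTsum _ hl' _ hz'
    have hr := mul_pos hε hμ0
    refine ⟨(hsumF l z (Metric.mem_ball_self hr) (Metric.mem_ball_self hr)).summable,
      contDiffAt_of_extension (F := fun l' z' => ∑' j : ℕ, neumannTerm θ V W φ ψ (M + j) l' z') hr
        hTsmooth fun l' z' hl' hz' => (hsumF l' z' hl' hz').tsum_eq, ?_⟩
    refine ((traceLe_mixedDeriv_of_scale (β := D * S) hε h1 (by positivity) M hTsmooth
      (fun l' z' hl' hz' => (hsumF l' z' hl' hz').tsum_eq) (fun p hp q hq => ?_) γ ν).mono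
        ?_).traceNorm_le
    · refine TraceLe.hasSum (hTsum p hp q hq)
        ((hsum.hasSum.mul_left D).mul_right ((1 / specParam V l z) ^ (M + 2))) fun j => ?_
      refine (trace l z hlz p hp q hq (M + j) (Nat.le_add_right M j)).mono (le_of_eq ?_)
      rw [Nat.add_sub_cancel_left]
      ring
    · gcongr ?_ * _
      exact le_add_of_nonneg_right zero_le_one
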